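/- Let $V=\mathfrak g^*$ be a finite-dimensional real vector space with dual space $V^*=\mathfrak g$, and let $X=(a_1,\dots,a_m)$ be a list of non-zero vectors spanning $V$ (for instance characters of a torus $G$, with $V=\mathfrak g^*$). A subspace $r\subset V$ is called rational (relative to $X$) if it is spanned by $X\cap r$; $\mathcal S_X$ denotes the set of rational subspaces, and $X\setminus r$, $X\cap r$ denote the sublists of the elements of $X$ outside, respectively inside, $r$. For a list $Y$ of vectors put $\partial_Y=\prod_{a\in Y}\partial_a$. A cocircuit of $X$ is a sublist $X\setminus H$, where $H$ is a rational hyperplane of $V$, and $D(X)$ is the space of polynomial functions $g$ on $V$ such that $\partial_Y g=0$ for every cocircuit $Y$ of $X$. In the same way $D(X\cap r)$ is a space of polynomial functions on $r$ for $r\in\mathcal S_X$; after a Lebesgue measure has been fixed on each $r$, its elements are regarded as polynomial densities on $r$, hence as tempered distributions on $V$ through the embedding $j:\mathcal S'(r)\to\mathcal S'(V)$, $j(\phi)(f)=\phi(f|_r)$. Let $$\mathcal G(X)=\{u\in\mathcal S'(V)\;:\;\partial_{X\setminus r}u\in j(\mathcal S'(r))\ \text{ for all } r\in\mathcal S_X\}.$$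 If a list $Z=(b_1,\dots,b_k)$ lies in an open half-space, $T_Z$ is the tempered distribution $\langle T_Z\,|\,f\rangle=\int_0^\infty\!\cdots\int_0^\infty f\bigl(\sum_i t_ib_i\bigr)\,dt_1\cdots dt_k$. A regular face for a list $Z$ of non-zero vectors is a connected component $F$ of $\{\varphi\in V^* : \varphi(a)\neq 0 \text{ for all } a\in Z\}$. If $A$ and $B$ are the sublists of $Z$ on which the elements of $F$ are positive, respectively negative, put $T_Z^F=(-1)^{|B|}T_{(A,-B)}$. Choose, for every $r\in\mathcal S_X$, a regular face $F_r$ for $X\setminus r$ that contains a linear form vanishing on $r$. Then for every $r\in\mathcal S_X$ and $g\in D(X\cap r)$ the convolution $T^{F_r}_{X\setminus r}*g$ is a well-defined tempered distribution on $V$, and $$\mathcal G(X)=\bigoplus_{r\in\mathcal S_X}T^{F_r}_{X\setminus r}*D(X\cap r),$$ an internal direct sum of linear subspaces of $\mathcal S'(V)$. This holds both for real and for complex scalars (values of polynomials and distributions). -/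

import Mathlib

open MeasureTheory Topology
open scoped SchwartzMap LineDeriv

noncomputable section

namespace Spline

/-! ### Lists of vectors and rational subspaces -/

section Lists

variable {V : Type*} [AddCommGroup V] [Module ℝ V]

/-- `r` is rational relative to the list `X`: it is spanned by the elements of `X` it contains. -/
def IsRational (X : List V) (r : Submodule ℝ V) : Prop :=
  r = Submodule.span ℝ {a | a ∈ X ∧ a ∈ r}

open scoped Classical in
/-- The sublist `X \ r` of the elements of `X` not lying in `r`. -/
def outside (X : List V) (r : Submodule ℝ V) : List V :=
  X.filter (fun a => a ∉ r)

open scoped Classical in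
/-- The sublist `X ∩ r` of the elements of `X` lying in `r`, as a list of vectors of the
vector space `r`. -/
def inside (X : List V) (r : Submodule ℝ V) : List r :=
  (X.filter (fun a => a ∈ r)).pmap Subtype.mk (fun a ha => by simpa using (List.mem_filter.1 ha).2)

/-- The cocircuits of `X` are the sublists `X \ H` with `H` a rational hyperplane. -/
def IsCocircuit (X Y : List V) : Prop :=
  ∃ H : Submodule ℝ V, IsRational X H ∧ Module.finrank ℝ H + 1 = Module.finrank ℝ V ∧
    Y = outside X H

end Lists

/-! ### Polynomial functions and the space `D(X)` -/

section Polynomials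

variable (𝕜 : Type*) [RCLike 𝕜]
variable {V : Type*} [NormedAddCommGroup V] [NormedSpace ℝ V]

/-- The algebra of `𝕜`-valued polynomial functions on the real vector space `V`: it is generated
over `𝕜` by the real linear forms. -/
def polyFun (V : Type*) [NormedAddCommGroup V] [NormedSpace ℝ V] : Subalgebra 𝕜 (V → 𝕜) :=
  Algebra.adjoin 𝕜 (Set.range fun (l : StrongDual ℝ V) (v : V) => ((l v : ℝ) : 𝕜))

variable {𝕜}

/-- The iterated derivative `∂_Y g = ∏_{a ∈ Y} ∂_a g` of a function. -/
def funDeriv (Y : List V) (g : V → 𝕜) : V → 𝕜 :=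
  Y.foldr (fun a h x => lineDeriv ℝ h x a) g

theorem polyFun_hasTemperateGrowth {g : V → 𝕜} (hg : g ∈ polyFun 𝕜 V) :
    g.HasTemperateGrowth := by
  refine Algebra.adjoin_induction (p := fun g _ => g.HasTemperateGrowth) ?_ ?_ ?_ ?_ hg
  · rintro _ ⟨l, rfl⟩
    exact (RCLike.ofRealCLM.comp l : V →L[ℝ] 𝕜).hasTemperateGrowth
  · intro c
    exact Function.HasTemperateGrowth.const c
  · intro f g _ _ hf hg
    exact hf.add hg
  · intro f g _ _ hf hg
    exact hf.mul hg

theorem polyFun_differentiable {g : V → 𝕜} (hg : g ∈ polyFun 𝕜 V) : Differentiable ℝ g :=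
  (polyFun_hasTemperateGrowth hg).1.differentiable (by simp)

theorem lineDeriv_add_polyFun {f g : V → 𝕜} (hf : f ∈ polyFun 𝕜 V) (hg : g ∈ polyFun 𝕜 V) (a : V) :
    (fun x => lineDeriv ℝ (f + g) x a) =
      (fun x => lineDeriv ℝ f x a) + fun x => lineDeriv ℝ g x a := by
  funext x
  have h1 := polyFun_differentiable hf x
  have h2 := polyFun_differentiable hg x
  simp [(h1.add h2).lineDeriv_eq_fderiv, h1.lineDeriv_eq_fderiv, h2.lineDeriv_eq_fderiv,
    fderiv_add h1 h2]

theorem lineDeriv_smul_polyFun {f : V → 𝕜} (c : 𝕜) (hf : f ∈ polyFun 𝕜 V) (a : V) :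
    (fun x => lineDeriv ℝ (c • f) x a) = c • fun x => lineDeriv ℝ f x a := by
  funext x
  have h1 := polyFun_differentiable hf x
  simp [(h1.const_smul c).lineDeriv_eq_fderiv, h1.lineDeriv_eq_fderiv, fderiv_const_smul h1]

theorem lineDeriv_mem_polyFun {g : V → 𝕜} (hg : g ∈ polyFun 𝕜 V) (a : V) :
    (fun x => lineDeriv ℝ g x a) ∈ polyFun 𝕜 V := by
  refine Algebra.adjoin_induction
    (p := fun g _ => (fun x => lineDeriv ℝ g x a) ∈ polyFun 𝕜 V) ?_ ?_ ?_ ?_ hg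
  · rintro _ ⟨l, rfl⟩
    have : (fun x => lineDeriv ℝ (fun v : V => ((l v : ℝ) : 𝕜)) x a) =
        algebraMap 𝕜 (V → 𝕜) ((l a : ℝ) : 𝕜) := by
      funext x
      have h := (RCLike.ofRealCLM.comp l : V →L[ℝ] 𝕜).hasFDerivAt (x := x)
      exact (h.hasLineDerivAt a).lineDeriv
    rw [this]
    exact Subalgebra.algebraMap_mem _ _
  · intro c
    have : (fun x => lineDeriv ℝ (algebraMap 𝕜 (V → 𝕜) c) x a) = 0 := by
      funext x
      simp [lineDeriv]
    rw [this]
    exact zero_mem _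
  · intro f g hf hg h1 h2
    rw [lineDeriv_add_polyFun hf hg]
    exact add_mem h1 h2
  · intro f g hf hg h1 h2
    have : (fun x => lineDeriv ℝ (f * g) x a) =
        f * (fun x => lineDeriv ℝ g x a) + g * fun x => lineDeriv ℝ f x a := by
      funext x
      have d1 := polyFun_differentiable hf x
      have d2 := polyFun_differentiable hg x
      simp [(d1.mul d2).lineDeriv_eq_fderiv, d1.lineDeriv_eq_fderiv, d2.lineDeriv_eq_fderiv,
        fderiv_mul d1 d2]
    rw [this]
    exact add_mem (mul_mem hf h2) (mul_mem hg h1)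

theorem funDeriv_mem_polyFun (Y : List V) {g : V → 𝕜} (hg : g ∈ polyFun 𝕜 V) :
    funDeriv Y g ∈ polyFun 𝕜 V := by
  induction Y with
  | nil => exact hg
  | cons a Y ih => exact lineDeriv_mem_polyFun ih a

theorem funDeriv_add (Y : List V) {f g : V → 𝕜} (hf : f ∈ polyFun 𝕜 V) (hg : g ∈ polyFun 𝕜 V) :
    funDeriv Y (f + g) = funDeriv Y f + funDeriv Y g := by
  induction Y with
  | nil => rfl
  | cons a Y ih =>
    change (fun x => lineDeriv ℝ (funDeriv Y (f + g)) x a) = _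
    rw [ih, lineDeriv_add_polyFun (funDeriv_mem_polyFun Y hf) (funDeriv_mem_polyFun Y hg)]
    rfl

theorem funDeriv_smul (Y : List V) (c : 𝕜) {f : V → 𝕜} (hf : f ∈ polyFun 𝕜 V) :
    funDeriv Y (c • f) = c • funDeriv Y f := by
  induction Y with
  | nil => rfl
  | cons a Y ih =>
    change (fun x => lineDeriv ℝ (funDeriv Y (c • f)) x a) = _
    rw [ih, lineDeriv_smul_polyFun c (funDeriv_mem_polyFun Y hf)]
    rfl

variable (𝕜) in
/-- The space `D(X)` of polynomial functions `g` on `V` with `∂_Y g = 0` for every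
cocircuit `Y` of `X`. -/
def DSpace (X : List V) : Submodule 𝕜 (V → 𝕜) where
  carrier := {g | g ∈ polyFun 𝕜 V ∧ ∀ Y, IsCocircuit X Y → funDeriv Y g = 0}
  zero_mem' := ⟨zero_mem _, fun Y _ => by
    simpa using funDeriv_smul Y (0 : 𝕜) (zero_mem (polyFun 𝕜 V))⟩
  add_mem' := fun hf hg => ⟨add_mem hf.1 hg.1, fun Y hY => by
    rw [funDeriv_add Y hf.1 hg.1, hf.2 Y hY, hg.2 Y hY, add_zero]⟩
  smul_mem' := fun c f hf => ⟨Subalgebra.smul_mem _ hf.1 c, fun Y hY => by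
    rw [funDeriv_smul Y c hf.1, hf.2 Y hY, smul_zero]⟩

end Polynomials

/-! ### Tempered distributions -/

section Distributions

variable (𝕜 : Type*) [RCLike 𝕜]
variable (V : Type*) [NormedAddCommGroup V] [NormedSpace ℝ V]

/-- The space `𝒮'(V)` of `𝕜`-valued tempered distributions on `V`
(real ones for `𝕜 = ℝ`, complex ones for `𝕜 = ℂ`). -/
abbrev TDist := 𝓢(V, 𝕜) →L[𝕜] 𝕜

variable {𝕜 V}

/-- The derivative `∂_a` of a tempered distribution: `⟨∂_a u | f⟩ = - ⟨u | ∂_a f⟩`. -/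
def distDeriv (a : V) : TDist 𝕜 V →ₗ[𝕜] TDist 𝕜 V where
  toFun u := -(u.comp (LineDeriv.lineDerivOpCLM 𝕜 𝓢(V, 𝕜) a))
  map_add' u w := by ext f; simp [add_comm]
  map_smul' c u := by ext f; simp

theorem distDeriv_apply (a : V) (u : TDist 𝕜 V) (f : 𝓢(V, 𝕜)) :
    distDeriv a u f = -u (∂_{a} f) := rfl

/-- The operator `∂_Y = ∏_{a ∈ Y} ∂_a` on tempered distributions. -/
def distDerivs (Y : List V) : TDist 𝕜 V →ₗ[𝕜] TDist 𝕜 V :=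
  Y.foldr (fun a L => (distDeriv a).comp L) LinearMap.id

variable (𝕜) in
/-- Restriction `f ↦ f|_r` of Schwartz functions to a subspace. -/
def restrictSchwartz (r : Submodule ℝ V) : 𝓢(V, 𝕜) →L[𝕜] 𝓢(r, 𝕜) :=
  SchwartzMap.compCLMOfAntilipschitz 𝕜 (g := r.subtypeL) (K := 1)
    r.subtypeL.hasTemperateGrowth (r.subtypeₗᵢ.isometry.antilipschitz)

theorem restrictSchwartz_apply (r : Submodule ℝ V) (f : 𝓢(V, 𝕜)) (y : r) :
    restrictSchwartz 𝕜 r f y = f y := rfl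

/-- The embedding `j : 𝒮'(r) → 𝒮'(V)`, `j(φ)(f) = φ(f|_r)`. -/
def extendDist (r : Submodule ℝ V) : TDist 𝕜 r →ₗ[𝕜] TDist 𝕜 V where
  toFun φ := φ.comp (restrictSchwartz 𝕜 r)
  map_add' _ _ := rfl
  map_smul' _ _ := rfl

variable (𝕜) in
/-- The space `𝒢(X)` of the tempered distributions `u` on `V` such that, for every rational
subspace `r`, the distribution `∂_{X \ r} u` belongs to the image of `𝒮'(r)` in `𝒮'(V)`. -/
def splineSpace (X : List V) : Submodule 𝕜 (TDist 𝕜 V) :=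
  ⨅ (r : Submodule ℝ V) (_ : IsRational X r),
    (LinearMap.range (extendDist (𝕜 := 𝕜) r)).comap (distDerivs (outside X r))

theorem mem_splineSpace {X : List V} {u : TDist 𝕜 V} :
    u ∈ splineSpace 𝕜 X ↔ ∀ r : Submodule ℝ V, IsRational X r →
      distDerivs (outside X r) u ∈ LinearMap.range (extendDist (𝕜 := 𝕜) r) := by
  simp [splineSpace]

/-- The translate `y ↦ f (x + y)` of a Schwartz function. -/
def translate (f : 𝓢(V, 𝕜)) (x : V) : 𝓢(V, 𝕜) := SchwartzMap.compSubConstCLM 𝕜 (-x) f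

theorem translate_apply (f : 𝓢(V, 𝕜)) (x y : V) : translate f x y = f (x + y) := by
  simp [translate, add_comm]

/-- `u` is the convolution `S * T`: for every test function `f` one has
`⟨u | f⟩ = ⟨S_x | ⟨T_y | f (x + y)⟩⟩`. The inner function `x ↦ ⟨T_y | f (x + y)⟩` need not be
a Schwartz function on all of `V`; it only has to coincide near the support of `S` with some
Schwartz function `ψ`, and then `⟨S | ψ⟩` does not depend on the choice of `ψ`. -/
def IsConvolution (S T u : TDist 𝕜 V) : Prop :=
  ∀ f : 𝓢(V, 𝕜), HasCompactSupport f →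
    ∃ ψ : 𝓢(V, 𝕜), (∀ᶠ x in 𝓝ˢ (Distribution.dsupport S), ψ x = T (translate f x)) ∧ u f = S ψ

/-- A regular face for the list `Z`: a connected component of the complement, in the dual space
`V*`, of the arrangement of the hyperplanes `a^⊥`, `a ∈ Z`. -/
def IsRegularFace (Z : List V) (F : Set (StrongDual ℝ V)) : Prop :=
  ∃ φ : StrongDual ℝ V, (∀ a ∈ Z, φ a ≠ 0) ∧
    F = connectedComponentIn {ψ : StrongDual ℝ V | ∀ a ∈ Z, ψ a ≠ 0} φ

open scoped Classical in
/-- The sublist `A` of `Z` of the vectors on which the face `F` is positive. -/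
def positivePart (Z : List V) (F : Set (StrongDual ℝ V)) : List V :=
  Z.filter (fun a => ∀ φ ∈ F, 0 < φ a)

open scoped Classical in
/-- The sublist `B` of `Z` of the vectors on which the face `F` is negative. -/
def negativePart (Z : List V) (F : Set (StrongDual ℝ V)) : List V :=
  Z.filter (fun a => ∀ φ ∈ F, φ a < 0)

variable [FiniteDimensional ℝ V] [MeasurableSpace V] [BorelSpace V]

/-- The distribution `f ↦ ∫ g f dlam` with polynomial density `g` with respect to the Lebesgue
(Haar) measure `lam`. -/
def density (lam : Measure V) [lam.IsAddHaarMeasure] (g : V → 𝕜) : TDist 𝕜 V :=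
  (SchwartzMap.integralCLM 𝕜 lam).comp (SchwartzMap.smulLeftCLM 𝕜 g)

theorem density_apply (lam : Measure V) [lam.IsAddHaarMeasure] {g : V → 𝕜}
    (hg : g ∈ polyFun 𝕜 V) (f : 𝓢(V, 𝕜)) : density lam g f = ∫ x, g x * f x ∂lam := by
  simp [density, SchwartzMap.smulLeftCLM_apply_apply (polyFun_hasTemperateGrowth hg)]

theorem density_add (lam : Measure V) [lam.IsAddHaarMeasure] {g h : V → 𝕜}
    (hg : g ∈ polyFun 𝕜 V) (hh : h ∈ polyFun 𝕜 V) :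
    density lam (g + h) = density lam g + density lam h := by
  rw [density, SchwartzMap.smulLeftCLM_add (polyFun_hasTemperateGrowth hg)
    (polyFun_hasTemperateGrowth hh), ContinuousLinearMap.comp_add]
  rfl

theorem density_smul (lam : Measure V) [lam.IsAddHaarMeasure] (c : 𝕜) {g : V → 𝕜}
    (hg : g ∈ polyFun 𝕜 V) : density lam (c • g) = c • density lam g := by
  rw [density, SchwartzMap.smulLeftCLM_smul (polyFun_hasTemperateGrowth hg),
    ContinuousLinearMap.comp_smul]
  rfl

/-! ### Multivariate splines -/

/-- The image of Lebesgue measure on the positive orthant under `t ↦ ∑ i, t_i a_i`, where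
`Z = (a_1, …, a_m)`. -/
def splineMeasure (Z : List V) : Measure V :=
  (volume.restrict {t : Fin Z.length → ℝ | ∀ i, 0 ≤ t i}).map (fun t => ∑ i, t i • Z.get i)

theorem splineMeasure_hasTemperateGrowth {Z : List V}
    (h : ∃ x : StrongDual ℝ V, ∀ a ∈ Z, 0 < x a) : (splineMeasure Z).HasTemperateGrowth := by
  obtain ⟨x, hx⟩ := h
  let L : (Fin Z.length → ℝ) → V := fun t => ∑ i, t i • Z.get i
  have hL : Continuous L := by fun_prop
  obtain ⟨c, hc, hcx⟩ : ∃ c : ℝ, 0 < c ∧ ∀ i, c ≤ x (Z.get i) := by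
    rcases isEmpty_or_nonempty (Fin Z.length) with he | hne
    · exact ⟨1, one_pos, fun i => he.elim i⟩
    · obtain ⟨i, hi⟩ := Finite.exists_min fun i => x (Z.get i)
      exact ⟨x (Z.get i), hx _ (List.get_mem _ _), hi⟩
  have hM : 0 < ‖x‖ + c := by positivity
  set δ : ℝ := c / (‖x‖ + c) with hδ
  have hδ0 : 0 < δ := by positivity
  have hδ1 : δ ≤ 1 := (div_le_one hM).2 (by linarith [norm_nonneg x])
  have key : ∀ t : Fin Z.length → ℝ, (∀ i, 0 ≤ t i) → δ * (1 + ‖t‖) ≤ 1 + ‖L t‖ := by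
    intro t ht
    have h1 : ‖t‖ ≤ ∑ i, t i := by
      refine (pi_norm_le_iff_of_nonneg (Finset.sum_nonneg fun i _ => ht i)).2 fun i => ?_
      rw [Real.norm_of_nonneg (ht i)]
      exact Finset.single_le_sum (fun j _ => ht j) (Finset.mem_univ i)
    have h2 : c * ∑ i, t i ≤ x (L t) := by
      simp only [L, map_sum, map_smul, smul_eq_mul, Finset.mul_sum]
      refine Finset.sum_le_sum fun i _ => ?_
      rw [mul_comm]
      exact mul_le_mul_of_nonneg_left (hcx i) (ht i)
    have h3 : x (L t) ≤ (‖x‖ + c) * ‖L t‖ := by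
      have := x.le_opNorm (L t)
      have h4 := le_abs_self (x (L t))
      rw [Real.norm_eq_abs] at this
      nlinarith [norm_nonneg (L t)]
    have h5 : δ * ‖t‖ ≤ ‖L t‖ := by
      rw [hδ, div_mul_eq_mul_div, div_le_iff₀ hM]
      nlinarith
    linarith
  refine ⟨(volume : Measure (Fin Z.length → ℝ)).integrablePower, ?_⟩
  set n := (volume : Measure (Fin Z.length → ℝ)).integrablePower
  have hint : Integrable (fun t : Fin Z.length → ℝ => δ ^ (-(n : ℝ)) * (1 + ‖t‖) ^ (-(n : ℝ)))
      (volume.restrict {t | ∀ i, 0 ≤ t i}) :=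
    ((Measure.integrable_pow_neg_integrablePower volume).const_mul _).restrict
  have hcont : Continuous fun v : V => (1 + ‖v‖) ^ (-(n : ℝ)) :=
    (continuous_const.add continuous_norm).rpow_const
      fun v => Or.inl (ne_of_gt (add_pos_of_pos_of_nonneg one_pos (norm_nonneg v)))
  have hset : MeasurableSet {t : Fin Z.length → ℝ | ∀ i, 0 ≤ t i} := by
    simp only [Set.ofPred_forall]
    exact MeasurableSet.iInter fun i => measurableSet_le measurable_const (measurable_pi_apply i)
  rw [splineMeasure, integrable_map_measure hcont.aestronglyMeasurable hL.aemeasurable]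
  refine hint.mono (hcont.comp hL).aestronglyMeasurable ?_
  filter_upwards [ae_restrict_mem hset] with t ht
  simp only [Function.comp_apply]
  rw [Real.norm_of_nonneg (by positivity), Real.norm_of_nonneg (by positivity),
    ← Real.mul_rpow hδ0.le (by positivity)]
  exact Real.rpow_le_rpow_of_nonpos (by positivity) (key t ht) (by simp)

open scoped Classical in
variable (𝕜) in
/-- The multivariate spline `T_Z` of a list `Z = (a_1, …, a_m)` contained in an open half-space:
`⟨T_Z | f⟩ = ∫_0^∞ … ∫_0^∞ f (∑ i, t_i a_i) dt_1 … dt_m`. (For other lists it is not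
defined, and set to be `0`.) -/
def multivariateSpline (Z : List V) : TDist 𝕜 V :=
  if h : ∃ x : StrongDual ℝ V, ∀ a ∈ Z, 0 < x a then
    haveI := splineMeasure_hasTemperateGrowth h
    SchwartzMap.integralCLM 𝕜 (splineMeasure Z)
  else 0

theorem multivariateSpline_apply {Z : List V} (h : ∃ x : StrongDual ℝ V, ∀ a ∈ Z, 0 < x a)
    (f : 𝓢(V, 𝕜)) :
    multivariateSpline 𝕜 Z f =
      ∫ t in {t : Fin Z.length → ℝ | ∀ i, 0 ≤ t i}, f (∑ i, t i • Z.get i) := by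
  have hL : Continuous fun t : Fin Z.length → ℝ => ∑ i, t i • Z.get i := by fun_prop
  rw [multivariateSpline, dif_pos h]
  have := splineMeasure_hasTemperateGrowth h
  rw [SchwartzMap.integralCLM_apply, splineMeasure,
    integral_map hL.aemeasurable f.continuous.aestronglyMeasurable]

variable (𝕜) in
/-- The distribution `T_Z^F = (-1)^{|B|} T_{(A, -B)}`. -/
def faceSpline (Z : List V) (F : Set (StrongDual ℝ V)) : TDist 𝕜 V :=
  (-1 : 𝕜) ^ (negativePart Z F).length •
    multivariateSpline 𝕜 (positivePart Z F ++ (negativePart Z F).map fun a => -a)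

variable (𝕜) in
/-- The space `T_{X \ r}^F * D(X ∩ r)` of the convolutions of `T_{X \ r}^F` with the
distributions supported on `r` given by the polynomial densities in `D(X ∩ r)`. -/
def splineSummand (X : List V) (r : Submodule ℝ V) (lam : Measure r) [lam.IsAddHaarMeasure]
    (F : Set (StrongDual ℝ V)) : Submodule 𝕜 (TDist 𝕜 V) where
  carrier := {u | ∃ g ∈ DSpace 𝕜 (inside X r),
    IsConvolution (faceSpline 𝕜 (outside X r) F) (extendDist r (density lam g)) u}
  zero_mem' := ⟨0, zero_mem _, fun f _ => ⟨0, Filter.Eventually.of_forall fun x => by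
    have : density lam (0 : r → 𝕜) = 0 := by
      have h := density_smul lam (0 : 𝕜) (zero_mem (polyFun 𝕜 r))
      rw [smul_zero] at h
      rw [h]
      ext f
      simp
    simp [this], by simp⟩⟩
  add_mem' := by
    rintro u v ⟨g, hg, hu⟩ ⟨h, hh, hv⟩
    refine ⟨g + h, add_mem hg hh, fun f hf => ?_⟩
    obtain ⟨ψ, h1, h2⟩ := hu f hf
    obtain ⟨χ, h3, h4⟩ := hv f hf
    refine ⟨ψ + χ, ?_, by simp [h2, h4]⟩
    filter_upwards [h1, h3] with x hx hx'
    simp [density_add lam hg.1 hh.1, hx, hx']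
  smul_mem' := by
    rintro c u ⟨g, hg, hu⟩
    refine ⟨c • g, Submodule.smul_mem _ c hg, fun f hf => ?_⟩
    obtain ⟨ψ, h1, h2⟩ := hu f hf
    refine ⟨c • ψ, ?_, by simp [h2]⟩
    filter_upwards [h1] with x hx
    simp [density_smul lam c hg.1, hx]

end Distributions

end Spline

end

/-!
Write `T_r * g` for the convolution of `T_{X \ r}^{F_r}` with a density `g ∈ D(X ∩ r)`. Everything
rests on two formulas, with `r` and `t` rational:

* `∂_{X \ r} (T_r * g) = g` (`distDerivs_outside_self`);
* `∂_{X \ t} (T_r * g) = 0` unless `r ≤ t` (`distDerivs_summand_eq_zero`), because otherwise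
  `X \ t` contains a cocircuit of `X ∩ r`, which kills `g`.

If `r ≤ t`, then `∂_{X \ t} (T_r * g)` is the spline of the remaining vectors `(X ∩ t) \ r`
convolved with `g`, hence is carried by `t`; so the summands lie in `𝒢(X)`
(`splineSummand_le_splineSpace`). The system is triangular with respect to dimension: applying
`∂_{X \ r}` for an `r` of minimal dimension among the nonzero terms of a vanishing sum gives
independence. For spanning, let `u ∈ 𝒢(X)` be killed by `∂_{X \ t}` for all rational `t` of
dimension less than `i`. For `r` of dimension `i`, the distribution `∂_{X \ r} u` comes from
a distribution on `r` killed by the cocircuits of `X ∩ r`, hence is a density `g_r ∈ D(X ∩ r)`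
(`exists_mem_DSpace`), and `u - ∑ T_r * g_r` is killed in dimension `i` as well.

The convolution is realized as an integral over an orthant times `r` (`coneDist`). A linear form `φ`
in `F_r` vanishing on `r` makes the parametrization of the cone proper, so that this integral is a
tempered distribution and the only one satisfying the definition of the convolution
(`isConvolution_iff`). It is characterized by its derivative `∂_W` and its support in `{φ ≥ 0}`,
since `∂_b` with `φ(b) > 0` is injective on the distributions supported there
(`HalfSupported.eq_zero_of_distDeriv`); this gives independence of the order of the list and
the commutation with derivatives along `r`.

That distributions killed by all cocircuits are polynomial is shown without the Fourier
transform. In the commutative algebra generated by the `∂_a`, every prime ideal containing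
the annihilator of the distribution contains all `∂_a`, so that all derivatives of high order vanish
(`exists_derivsVanish`); an induction with the Euler operator reduces to vanishing first
derivatives, and then the distribution is a constant density by the symmetry of convolution
(`DerivsVanish.mem_polyDensity`, `exists_eq_density_const`).
-/

namespace Spline

/-! ### Density of compactly supported functions -/

section Density

variable {𝕜 : Type*} [RCLike 𝕜] {V : Type*} [NormedAddCommGroup V] [NormedSpace ℝ V]
  [FiniteDimensional ℝ V]

/-- The derivatives of `1 - χ`, for a bump function `χ` equal to `1` near the origin, are bounded
and vanish near the origin, hence are bounded by multiples of the norm. -/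
theorem exists_cutoff : ∃ χ : V → ℝ, ContDiff ℝ (⊤ : ℕ∞) χ ∧ HasCompactSupport χ ∧
    ∀ i : ℕ, ∃ C : ℝ, 0 ≤ C ∧ ∀ y, ‖iteratedFDeriv ℝ i (fun x => 1 - χ x) y‖ ≤ C * ‖y‖ := by
  let χ : ContDiffBump (0 : V) := ⟨1, 2, one_pos, by norm_num⟩
  have hχ : ContDiff ℝ (⊤ : ℕ∞) (χ : V → ℝ) := χ.contDiff
  refine ⟨χ, hχ, χ.hasCompactSupport, fun i => ?_⟩
  obtain ⟨C₁, hC₁⟩ := (χ.hasCompactSupport.iteratedFDeriv (𝕜 := ℝ) i).exists_bound_of_continuous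
    (hχ.continuous_iteratedFDeriv (by exact_mod_cast le_top))
  obtain ⟨C₂, hC₂⟩ : ∃ C₂ : ℝ, ∀ y : V, ‖iteratedFDeriv ℝ i (fun _ : V => (1 : ℝ)) y‖ ≤ C₂ := by
    rcases Nat.eq_zero_or_pos i with rfl | hi
    · exact ⟨1, fun y => by simp⟩
    · exact ⟨0, fun y => by rw [iteratedFDeriv_const_of_ne hi.ne']; simp⟩
  have hb : ∀ y, ‖iteratedFDeriv ℝ i (fun x => 1 - χ x) y‖ ≤ C₂ + C₁ := fun y => by
    have : iteratedFDeriv ℝ i (fun x => 1 - χ x) y =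
        iteratedFDeriv ℝ i (fun _ : V => (1 : ℝ)) y - iteratedFDeriv ℝ i χ y :=
      fun_iteratedFDeriv_sub_apply (contDiff_const.contDiffAt)
        ((hχ.of_le (by exact_mod_cast le_top)).contDiffAt)
    rw [this]
    exact (norm_sub_le _ _).trans (add_le_add (hC₂ y) (hC₁ y))
  have h0 : 0 ≤ C₂ + C₁ := (norm_nonneg _).trans (hb 0)
  refine ⟨C₂ + C₁, h0, fun y => ?_⟩
  rcases lt_or_ge ‖y‖ 1 with hy | hy
  · have : (fun x => 1 - χ x) =ᶠ[𝓝 y] fun _ => (0 : ℝ) := by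
      filter_upwards [Metric.isOpen_ball.mem_nhds
        (show y ∈ Metric.ball (0 : V) 1 by simpa using hy)] with x hx
      rw [χ.one_of_mem_closedBall (Metric.ball_subset_closedBall hx), sub_self]
    rw [(this.iteratedFDeriv ℝ i).eq_of_nhds]
    have : iteratedFDeriv ℝ i (fun _ : V => (0 : ℝ)) y = 0 := by
      rw [iteratedFDeriv_fun_zero]; rfl
    rw [this]
    simpa using mul_nonneg h0 (norm_nonneg y)
  · exact (hb y).trans (le_mul_of_one_le_right h0 hy)

/-- Cutting off at radius `R` changes every Schwartz seminorm by a quantity of order `1 / R`. -/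
theorem dense_hasCompactSupport : Dense {f : 𝓢(V, 𝕜) | HasCompactSupport f} := by
  obtain ⟨χ, hχ, hχc, hC⟩ := exists_cutoff (V := V)
  choose C hC0 hC using hC
  intro f
  let ε : ℕ → ℝ := fun n => 1 / ((n : ℝ) + 1)
  have hε0 : ∀ n, 0 < ε n := fun n => Nat.one_div_pos_of_nat
  have hε1 : ∀ n, ε n ≤ 1 := fun n => by
    simpa [ε] using Nat.one_div_le_one_div (α := ℝ) (Nat.zero_le n)
  let s : ℕ → V → ℝ := fun n x => χ (ε n • x)
  have hs : ∀ n, ContDiff ℝ (⊤ : ℕ∞) (s n) := fun n => hχ.comp (contDiff_const_smul _)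
  have hsc : ∀ n, HasCompactSupport (s n) := fun n =>
    hχc.comp_homeomorph (Homeomorph.smulOfNeZero (ε n) (hε0 n).ne')
  have hgc : ∀ n, HasCompactSupport fun x => s n x • f x := fun n => (hsc n).smul_right
  have hgd : ∀ n, ContDiff ℝ (⊤ : ℕ∞) fun x => s n x • f x := fun n =>
    (hs n).smul (f.smooth ⊤)
  let g : ℕ → 𝓢(V, 𝕜) := fun n => (hgc n).toSchwartzMap (hgd n)
  have hlim : Filter.Tendsto g Filter.atTop (𝓝 f) := by
    rw [(schwartz_withSeminorms 𝕜 V 𝕜).tendsto_nhds]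
    rintro ⟨k, n⟩ δ hδ
    -- the seminorm of `g m - f` is at most a constant times `ε m`
    let M : ℝ := ∑ i ∈ Finset.range (n + 1),
      (n.choose i : ℝ) * C i * SchwartzMap.seminorm 𝕜 (k + 1) (n - i) f
    have hM0 : 0 ≤ M := Finset.sum_nonneg fun i _ =>
      mul_nonneg (mul_nonneg (Nat.cast_nonneg _) (hC0 i)) (apply_nonneg _ _)
    have hbound : ∀ m, SchwartzMap.seminorm 𝕜 k n (g m - f) ≤ ε m * M := by
      intro m
      rw [← neg_sub, map_neg_eq_map]
      refine SchwartzMap.seminorm_le_bound 𝕜 k n _ (mul_nonneg (hε0 m).le hM0) fun x => ?_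
      let η : V → ℝ := fun x => 1 - χ x
      have hη : ContDiff ℝ (⊤ : ℕ∞) η := contDiff_const.sub hχ
      have heq : ((f - g m : 𝓢(V, 𝕜)) : V → 𝕜) =
          fun x => (η ∘ (ε m • ContinuousLinearMap.id ℝ V)) x • f x := by
        funext x
        change f x - s m x • f x = (1 - χ (ε m • x)) • f x
        rw [sub_smul, one_smul]
      have hηε : ∀ i, ‖iteratedFDeriv ℝ i (η ∘ (ε m • ContinuousLinearMap.id ℝ V)) x‖ ≤
          C i * (ε m * ‖x‖) := by
        intro i
        rw [ContinuousLinearMap.iteratedFDeriv_comp_right _ hη x (by exact_mod_cast le_top)]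
        refine (ContinuousMultilinearMap.norm_compContinuousLinearMap_le _ _).trans ?_
        have h1 : ‖ε m • ContinuousLinearMap.id ℝ V‖ ≤ 1 := by
          refine ContinuousLinearMap.opNorm_le_bound _ zero_le_one fun y => ?_
          simp only [FunLike.coe_smul, Pi.smul_apply, ContinuousLinearMap.coe_id',
            id_eq, norm_smul, Real.norm_of_nonneg (hε0 m).le]
          exact mul_le_mul_of_nonneg_right (hε1 m) (norm_nonneg y)
        have h2 : ∏ _j : Fin i, ‖ε m • ContinuousLinearMap.id ℝ V‖ ≤ 1 :=
          Finset.prod_le_one (fun _ _ => norm_nonneg _) fun _ _ => h1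
        refine (mul_le_of_le_one_right (norm_nonneg _) h2).trans ((hC i _).trans (le_of_eq ?_))
        simp [norm_smul, abs_of_pos (hε0 m)]
      rw [heq]
      have h3 := norm_iteratedFDeriv_smul_le (𝕜 := ℝ) (N := (⊤ : ℕ∞))
        (hη.comp (ContinuousLinearMap.contDiff (ε m • ContinuousLinearMap.id ℝ V)))
        (f.smooth ⊤) x (n := n) (by exact_mod_cast le_top)
      refine (mul_le_mul_of_nonneg_left h3 (by positivity)).trans ?_
      rw [Finset.mul_sum, Finset.mul_sum]
      refine Finset.sum_le_sum fun i _ => ?_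
      have h4 := SchwartzMap.le_seminorm 𝕜 (k + 1) (n - i) f x
      calc ‖x‖ ^ k * ((n.choose i : ℝ) *
            ‖iteratedFDeriv ℝ i (η ∘ (ε m • ContinuousLinearMap.id ℝ V)) x‖ *
            ‖iteratedFDeriv ℝ (n - i) f x‖)
          ≤ ‖x‖ ^ k * ((n.choose i : ℝ) * (C i * (ε m * ‖x‖)) *
            ‖iteratedFDeriv ℝ (n - i) f x‖) := by gcongr; exact hηε i
        _ = ε m * ((n.choose i : ℝ) * C i * (‖x‖ ^ (k + 1) * ‖iteratedFDeriv ℝ (n - i) f x‖)) := by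
            ring
        _ ≤ ε m * ((n.choose i : ℝ) * C i * SchwartzMap.seminorm 𝕜 (k + 1) (n - i) f) := by
            have := hC0 i
            have := (hε0 m).le
            gcongr
    have ht : Filter.Tendsto (fun m => ε m * M) Filter.atTop (𝓝 0) := by
      simpa only [zero_mul] using
        (tendsto_one_div_add_atTop_nhds_zero_nat (𝕜 := ℝ)).mul_const M
    filter_upwards [ht.eventually_lt_const hδ] with m hm
    exact (hbound m).trans_lt hm
  exact mem_closure_of_tendsto hlim (Filter.Eventually.of_forall fun n => hgc n)

/-- A tempered distribution is determined by its values on compactly supported functions. -/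
theorem tdist_ext {u v : TDist 𝕜 V} (h : ∀ f : 𝓢(V, 𝕜), HasCompactSupport f → u f = v f) :
    u = v :=
  ContinuousLinearMap.ext fun f => congrFun
    (Continuous.ext_on dense_hasCompactSupport u.continuous v.continuous h) f

end Density

/-! ### Superpositions of translates -/

section Smear

variable {𝕜 : Type*} [RCLike 𝕜] {V : Type*} [NormedAddCommGroup V] [NormedSpace ℝ V]
  [FiniteDimensional ℝ V] [MeasurableSpace V] [BorelSpace V]
  {Ω : Type*} [MeasurableSpace Ω] {μ : Measure Ω}

omit [NormedSpace ℝ V] [FiniteDimensional ℝ V] in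
theorem integrable_smear {k : Ω → 𝕜} (hk : Integrable k μ) {φ : Ω → V} (hφ : Measurable φ)
    {f : V → 𝕜} (hf : Continuous f) (hfc : HasCompactSupport f) (x : V) :
    Integrable (fun ω => k ω * f (x + φ ω)) μ := by
  obtain ⟨C, hC⟩ := hfc.exists_bound_of_continuous hf
  have h := hk.bdd_mul (c := C) (f := fun ω => f (x + φ ω))
    (hf.measurable.comp (hφ.const_add x)).aestronglyMeasurable
    (Filter.Eventually.of_forall fun ω => hC _)
  simpa [mul_comm] using h

theorem hasFDerivAt_smear {k : Ω → 𝕜} (hk : Integrable k μ) {φ : Ω → V} (hφ : Measurable φ)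
    {f : V → 𝕜} (hf : ContDiff ℝ 1 f) (hfc : HasCompactSupport f) (x : V) :
    HasFDerivAt (fun x => ∫ ω, k ω * f (x + φ ω) ∂μ)
      (∫ ω, k ω • fderiv ℝ f (x + φ ω) ∂μ) x ∧
    Integrable (fun ω => k ω • fderiv ℝ f (x + φ ω)) μ := by
  have hf' : Continuous (fderiv ℝ f) := hf.continuous_fderiv (by simp)
  obtain ⟨C, hC⟩ := (hfc.fderiv (𝕜 := ℝ)).exists_bound_of_continuous hf'
  have hm : ∀ x, AEStronglyMeasurable (fun ω => k ω • fderiv ℝ f (x + φ ω)) μ := fun x =>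
    hk.aestronglyMeasurable.smul
      (hf'.stronglyMeasurable.comp_measurable (hφ.const_add x)).aestronglyMeasurable
  have hb : ∀ x ω, ‖k ω • fderiv ℝ f (x + φ ω)‖ ≤ ‖k ω‖ * C := fun x ω => by
    rw [norm_smul]
    exact mul_le_mul_of_nonneg_left (hC _) (norm_nonneg _)
  have hi : Integrable (fun ω => ‖k ω‖ * C) μ := hk.norm.mul_const C
  refine ⟨?_, hi.mono' (hm x) (Filter.Eventually.of_forall (hb x))⟩
  refine hasFDerivAt_integral_of_dominated_of_fderiv_le (𝕜 := ℝ)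
    (F' := fun x ω => k ω • fderiv ℝ f (x + φ ω)) Filter.univ_mem
    (Filter.Eventually.of_forall fun y => (integrable_smear hk hφ hf.continuous hfc y).1)
    (integrable_smear hk hφ hf.continuous hfc x) (hm x)
    (Filter.Eventually.of_forall fun ω y _ => hb y ω) hi
    (Filter.Eventually.of_forall fun ω y _ => ?_)
  have h1 : HasFDerivAt (fun y => f (y + φ ω)) (fderiv ℝ f (y + φ ω)) y := by
    rw [hasFDerivAt_comp_add_right]
    exact (hf.differentiable (by simp) _).hasFDerivAt
  exact h1.const_mul (k ω)

theorem contDiff_smear {k : Ω → 𝕜} (hk : Integrable k μ) {φ : Ω → V} (hφ : Measurable φ)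
    (n : ℕ) : ∀ {f : V → 𝕜}, ContDiff ℝ (⊤ : ℕ∞) f → HasCompactSupport f →
    ContDiff ℝ n (fun x => ∫ ω, k ω * f (x + φ ω) ∂μ) := by
  induction n with
  | zero =>
    intro f hf hfc
    exact contDiff_zero.2 (continuous_iff_continuousAt.2 fun x =>
      (hasFDerivAt_smear hk hφ (hf.of_le (by exact_mod_cast le_top)) hfc x).1.continuousAt)
  | succ n ih =>
    intro f hf hfc
    have h := hasFDerivAt_smear hk hφ (hf.of_le (by exact_mod_cast le_top)) hfc
    rw [Nat.cast_succ, contDiff_succ_iff_fderiv_apply]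
    refine ⟨fun x => (h x).1.differentiableAt, by simp, fun y => ?_⟩
    have hd : ContDiff ℝ (⊤ : ℕ∞) (fun x => fderiv ℝ f x y) :=
      (hf.fderiv_right (m := (⊤ : ℕ∞)) (by simp)).clm_apply contDiff_const
    have := ih hd (hfc.fderiv_apply (𝕜 := ℝ) y)
    convert this using 2 with x
    rw [(h x).1.fderiv, ContinuousLinearMap.integral_apply (h x).2]
    rfl

/-- The superposition `x ↦ ∫ k(ω) f(x + φ(ω)) dω` of translates of a compactly supported test
function is a compactly supported test function when the shifts `φ` stay in a compact set, and
differentiation commutes with the integral. -/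
theorem exists_smear {k : Ω → 𝕜} (hk : Integrable k μ) {φ : Ω → V} (hφ : Measurable φ)
    {K : Set V} (hK : IsCompact K) (hkK : ∀ ω, k ω ≠ 0 → φ ω ∈ K)
    (f : 𝓢(V, 𝕜)) (hfc : HasCompactSupport f) :
    ∃ h : 𝓢(V, 𝕜), HasCompactSupport h ∧ (∀ x, h x = ∫ ω, k ω * f (x + φ ω) ∂μ) ∧
      ∀ (a : V) x, (∂_{a} h : 𝓢(V, 𝕜)) x = ∫ ω, k ω * (∂_{a} f : 𝓢(V, 𝕜)) (x + φ ω) ∂μ := by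
  have hd : ContDiff ℝ (⊤ : ℕ∞) (fun x => ∫ ω, k ω * f (x + φ ω) ∂μ) :=
    contDiff_infty.2 fun n => contDiff_smear hk hφ n (f.smooth ⊤) hfc
  have hc : HasCompactSupport (fun x => ∫ ω, k ω * f (x + φ ω) ∂μ) := by
    refine HasCompactSupport.of_support_subset_isCompact
      ((IsCompact.prod hfc hK).image continuous_sub) fun x hx => ?_
    by_contra hxK
    refine hx (integral_eq_zero_of_ae (Filter.Eventually.of_forall fun ω => ?_))
    by_cases hω : k ω = 0
    · simp [hω]
    · have : f (x + φ ω) = 0 := by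
        by_contra h0
        exact hxK ⟨(x + φ ω, φ ω), ⟨subset_tsupport _ h0, hkK ω hω⟩, by simp⟩
      simp [this]
  refine ⟨hc.toSchwartzMap hd, hc, fun x => rfl, fun a x => ?_⟩
  have h := hasFDerivAt_smear hk hφ (f.smooth 1) hfc x
  rw [SchwartzMap.lineDerivOp_apply_eq_fderiv]
  change fderiv ℝ (fun x => ∫ ω, k ω * f (x + φ ω) ∂μ) x a = _
  rw [h.1.fderiv, ContinuousLinearMap.integral_apply h.2]
  simp only [SchwartzMap.lineDerivOp_apply_eq_fderiv]
  rfl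

end Smear


/-! ### Iterated derivatives of distributions -/

section Derivs

variable {𝕜 : Type*} [RCLike 𝕜] {V : Type*} [NormedAddCommGroup V] [NormedSpace ℝ V]

theorem lineDerivOp_comm (a b : V) (f : 𝓢(V, 𝕜)) :
    (∂_{a} (∂_{b} f : 𝓢(V, 𝕜)) : 𝓢(V, 𝕜)) = ∂_{b} (∂_{a} f : 𝓢(V, 𝕜)) := by
  have h : ∀ (a b : V) x, (∂_{a} (∂_{b} f : 𝓢(V, 𝕜)) : 𝓢(V, 𝕜)) x =
      fderiv ℝ (fderiv ℝ f) x a b := by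
    intro a b x
    rw [SchwartzMap.lineDerivOp_apply_eq_fderiv]
    have h1 : ((∂_{b} f : 𝓢(V, 𝕜)) : V → 𝕜) = fun x => fderiv ℝ f x b := by
      funext x
      rw [SchwartzMap.lineDerivOp_apply_eq_fderiv]
    have h2 : DifferentiableAt ℝ (fderiv ℝ f) x :=
      ((f.smooth 2).fderiv_right (m := 1) (by norm_num)).differentiable (by simp) x
    rw [h1, fderiv_clm_apply h2 (differentiableAt_const b)]
    simp
  ext x
  rw [h, h]
  exact ((f.smooth 2).contDiffAt.isSymmSndFDerivAt (by simp)) a b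

theorem distDeriv_comm (a b : V) (u : TDist 𝕜 V) :
    distDeriv a (distDeriv b u) = distDeriv b (distDeriv a u) := by
  ext f
  simp only [distDeriv_apply, neg_neg, lineDerivOp_comm a b]

theorem distDeriv_add (a b : V) (u : TDist 𝕜 V) :
    distDeriv (a + b) u = distDeriv a u + distDeriv b u := by
  ext f
  have : (∂_{a + b} f : 𝓢(V, 𝕜)) = ∂_{a} f + ∂_{b} f := by
    ext x
    simp [SchwartzMap.lineDerivOp_apply_eq_fderiv]
  simp [distDeriv_apply, this, add_comm]

theorem distDeriv_smul (c : ℝ) (a : V) (u : TDist 𝕜 V) :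
    distDeriv (c • a) u = (c : 𝕜) • distDeriv a u := by
  ext f
  have : (∂_{c • a} f : 𝓢(V, 𝕜)) = (c : 𝕜) • (∂_{a} f : 𝓢(V, 𝕜)) := by
    ext x
    simp [SchwartzMap.lineDerivOp_apply_eq_fderiv, RCLike.real_smul_eq_coe_mul]
  simp [distDeriv_apply, this, RCLike.real_smul_eq_coe_mul]

theorem distDeriv_neg (a : V) (u : TDist 𝕜 V) : distDeriv (-a) u = -distDeriv a u := by
  ext f
  simp [distDeriv_apply, LineDeriv.lineDerivOp_left_neg]

theorem distDerivs_cons (a : V) (Y : List V) (u : TDist 𝕜 V) :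
    distDerivs (a :: Y) u = distDeriv a (distDerivs Y u) := rfl

theorem distDerivs_append (Y Z : List V) (u : TDist 𝕜 V) :
    distDerivs (Y ++ Z) u = distDerivs Y (distDerivs Z u) := by
  induction Y with
  | nil => rfl
  | cons a Y ih => rw [List.cons_append, distDerivs_cons, ih, distDerivs_cons]

theorem distDerivs_distDeriv_comm (Y : List V) (a : V) (u : TDist 𝕜 V) :
    distDerivs Y (distDeriv a u) = distDeriv a (distDerivs Y u) := by
  induction Y with
  | nil => rfl
  | cons b Y ih => rw [distDerivs_cons, ih, distDeriv_comm, distDerivs_cons]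

theorem distDerivs_comm (Y Z : List V) (u : TDist 𝕜 V) :
    distDerivs Y (distDerivs Z u) = distDerivs Z (distDerivs Y u) := by
  induction Y with
  | nil => rfl
  | cons b Y ih => rw [distDerivs_cons, ih, ← distDerivs_distDeriv_comm, distDerivs_cons]

theorem distDerivs_perm {Y Z : List V} (h : Y.Perm Z) (u : TDist 𝕜 V) :
    distDerivs Y u = distDerivs Z u := by
  induction h with
  | nil => rfl
  | cons a _ ih => rw [distDerivs_cons, ih, distDerivs_cons]
  | swap a b l => simp only [distDerivs_cons, distDeriv_comm a b]
  | trans _ _ h1 h2 => rw [h1, h2]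

theorem distDerivs_eq_zero_of_sublist {Y Z : List V} (h : Y.Sublist Z) {u : TDist 𝕜 V}
    (hu : distDerivs Y u = 0) : distDerivs Z u = 0 := by
  induction h generalizing u with
  | slnil => exact hu
  | cons a _ ih => rw [distDerivs_cons, ih hu, map_zero]
  | cons_cons a _ ih =>
    rw [distDerivs_cons, ← distDerivs_distDeriv_comm] at hu ⊢
    exact ih hu

theorem distDerivs_map_neg (B : List V) (u : TDist 𝕜 V) :
    distDerivs (B.map fun a => -a) u = (-1 : 𝕜) ^ B.length • distDerivs B u := by
  induction B with
  | nil => simp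
  | cons a B ih =>
    rw [List.map_cons, distDerivs_cons, ih, distDerivs_cons, distDeriv_neg, map_smul,
      List.length_cons]
    ext f
    simp [pow_succ]

end Derivs

/-! ### Distributions carried by a subspace -/

section Extend

variable {𝕜 : Type*} [RCLike 𝕜] {V : Type*} [NormedAddCommGroup V] [NormedSpace ℝ V]

theorem extendDist_apply (r : Submodule ℝ V) (w : TDist 𝕜 r) (f : 𝓢(V, 𝕜)) :
    extendDist r w f = w (restrictSchwartz 𝕜 r f) := rfl

theorem distDeriv_extendDist (r : Submodule ℝ V) (a : r) (w : TDist 𝕜 r) :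
    distDeriv (a : V) (extendDist r w) = extendDist r (distDeriv a w) := by
  ext f
  rw [distDeriv_apply, extendDist_apply, extendDist_apply, distDeriv_apply]
  congr 2
  ext x
  rw [restrictSchwartz_apply, SchwartzMap.lineDerivOp_apply, SchwartzMap.lineDerivOp_apply]
  rfl

theorem distDerivs_extendDist (r : Submodule ℝ V) (Y : List r) (w : TDist 𝕜 r) :
    distDerivs (Y.map Subtype.val) (extendDist r w) = extendDist r (distDerivs Y w) := by
  induction Y with
  | nil => rfl
  | cons a Y ih => rw [List.map_cons, distDerivs_cons, ih, distDeriv_extendDist, distDerivs_cons]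

variable [FiniteDimensional ℝ V]

/-- Every compactly supported test function on a subspace is a restriction: compose it with a
projection and multiply by a cutoff in the complementary directions. -/
theorem exists_restrictSchwartz_eq (r : Submodule ℝ V) (f : 𝓢(r, 𝕜)) (hf : HasCompactSupport f) :
    ∃ g : 𝓢(V, 𝕜), restrictSchwartz 𝕜 r g = f := by
  obtain ⟨π, hπ⟩ := (Submodule.ClosedComplemented.of_finiteDimensional_quotient
    r.closed_of_finiteDimensional : r.ClosedComplemented)
  let χ : ContDiffBump (0 : V) := ⟨1, 2, one_pos, by norm_num⟩
  have hd : ContDiff ℝ (⊤ : ℕ∞) fun x : V => χ (x - π x) • f (π x) :=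
    (χ.contDiff.comp (contDiff_id.sub (r.subtypeL.comp π).contDiff)).smul
      ((f.smooth ⊤).comp π.contDiff)
  have hc : HasCompactSupport fun x : V => χ (x - π x) • f (π x) := by
    have hK : IsCompact ((fun p : r × V => (p.1 : V) + p.2) '' (tsupport f ×ˢ tsupport χ)) :=
      (IsCompact.prod hf χ.hasCompactSupport).image (by fun_prop)
    refine HasCompactSupport.of_support_subset_isCompact hK fun x hx => ?_
    have h1 : χ (x - π x) ≠ 0 := fun h => hx (by simp [h])
    have h2 : f (π x) ≠ 0 := fun h => hx (by simp [h])
    exact ⟨(π x, x - π x), ⟨subset_tsupport _ h2, subset_tsupport _ h1⟩, by simp⟩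
  refine ⟨hc.toSchwartzMap hd, ?_⟩
  ext y
  rw [restrictSchwartz_apply]
  change χ ((y : V) - π y) • f (π y) = f y
  rw [hπ, sub_self, χ.one_of_mem_closedBall (by simp [χ.rIn_pos.le]), one_smul]

theorem extendDist_injective (r : Submodule ℝ V) :
    Function.Injective (extendDist (𝕜 := 𝕜) r) := by
  refine fun v w h => tdist_ext fun f hf => ?_
  obtain ⟨g, rfl⟩ := exists_restrictSchwartz_eq r f hf
  exact congrArg (fun u : TDist 𝕜 V => u g) h

end Extend

/-! ### Polynomial densities -/

section Densities

variable {𝕜 : Type*} [RCLike 𝕜] {V : Type*} [NormedAddCommGroup V] [NormedSpace ℝ V]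
  [FiniteDimensional ℝ V] [MeasurableSpace V] [BorelSpace V]
  (lam : Measure V) [lam.IsAddHaarMeasure]

theorem integrable_polyFun_mul {g : V → 𝕜} (hg : g ∈ polyFun 𝕜 V) (f : 𝓢(V, 𝕜)) :
    Integrable (fun x => g x * f x) lam := by
  have h := (SchwartzMap.smulLeftCLM 𝕜 g f).integrable (μ := lam)
  refine h.congr (Filter.Eventually.of_forall fun x => ?_)
  simp [SchwartzMap.smulLeftCLM_apply_apply (polyFun_hasTemperateGrowth hg)]

theorem distDeriv_density {g : V → 𝕜} (hg : g ∈ polyFun 𝕜 V) (a : V) :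
    distDeriv a (density lam g) = density lam fun x => lineDeriv ℝ g x a := by
  ext f
  rw [distDeriv_apply, density_apply lam hg, density_apply lam (lineDeriv_mem_polyFun hg a)]
  have h := integral_bilinear_hasLineDerivAt_right_eq_neg_left_of_integrable (μ := lam)
    (B := ContinuousLinearMap.mul ℝ 𝕜) (f := g) (f' := fun x => lineDeriv ℝ g x a)
    (g := f) (g' := (∂_{a} f : 𝓢(V, 𝕜))) (v := a)
    (integrable_polyFun_mul lam (lineDeriv_mem_polyFun hg a) f)
    (integrable_polyFun_mul lam hg _) (integrable_polyFun_mul lam hg f)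
    (fun x _ => (polyFun_differentiable hg x).lineDifferentiableAt.hasLineDerivAt)
    (fun x _ => by
      rw [SchwartzMap.lineDerivOp_apply]
      exact (f.differentiable x).lineDifferentiableAt.hasLineDerivAt)
  simp only [ContinuousLinearMap.mul_apply'] at h
  rw [h, neg_neg]

theorem distDerivs_density {g : V → 𝕜} (hg : g ∈ polyFun 𝕜 V) (Y : List V) :
    distDerivs Y (density lam g) = density lam (funDeriv Y g) := by
  induction Y with
  | nil => rfl
  | cons a Y ih =>
    rw [distDerivs_cons, ih, distDeriv_density lam (funDeriv_mem_polyFun Y hg)]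
    rfl

theorem density_zero : density lam (0 : V → 𝕜) = 0 := by
  have h := density_smul lam (0 : 𝕜) (zero_mem (polyFun 𝕜 V))
  rw [smul_zero] at h
  rw [h]
  ext f
  simp

theorem eq_zero_of_density_eq_zero {g : V → 𝕜} (hg : g ∈ polyFun 𝕜 V)
    (h : density lam g = 0) : g = 0 := by
  have hc : Continuous g := (polyFun_differentiable hg).continuous
  have h0 : ∀ᵐ x ∂lam, g x = 0 := by
    refine ae_eq_zero_of_integral_contDiff_smul_eq_zero hc.locallyIntegrable fun η hη hηc => ?_
    have hd : ContDiff ℝ (⊤ : ℕ∞) fun x => ((η x : ℝ) : 𝕜) :=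
      (RCLike.ofRealCLM (K := 𝕜)).contDiff.comp hη
    have hcs : HasCompactSupport fun x => ((η x : ℝ) : 𝕜) :=
      hηc.comp_left (g := fun t : ℝ => (t : 𝕜)) (by simp)
    have h1 := congrArg (fun u : TDist 𝕜 V => u (hcs.toSchwartzMap hd)) h
    simp only [density_apply lam hg, zero_apply] at h1
    rw [← h1]
    refine integral_congr_ae (Filter.Eventually.of_forall fun x => ?_)
    change η x • g x = g x * (η x : 𝕜)
    rw [RCLike.real_smul_eq_coe_mul, mul_comm]
  exact (Continuous.ae_eq_iff_eq lam hc continuous_zero).1 h0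

end Densities

/-! ### Distributions supported in a half-space -/

section HalfSpace

variable {𝕜 : Type*} [RCLike 𝕜] {V : Type*} [NormedAddCommGroup V] [NormedSpace ℝ V]

/-- The tempered distribution `u` is supported in the half-space `{φ ≥ 0}`; it suffices to test
this on compactly supported functions. -/
def HalfSupported (φ : StrongDual ℝ V) (u : TDist 𝕜 V) : Prop :=
  ∀ f : 𝓢(V, 𝕜), HasCompactSupport f → tsupport f ⊆ {x | φ x < 0} → u f = 0

theorem HalfSupported.sub {φ : StrongDual ℝ V} {u v : TDist 𝕜 V} (hu : HalfSupported φ u)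
    (hv : HalfSupported φ v) : HalfSupported φ (u - v) := fun f h1 h2 => by
  simp [hu f h1 h2, hv f h1 h2]

theorem halfSupported_distDeriv {φ : StrongDual ℝ V} {u : TDist 𝕜 V} (hu : HalfSupported φ u)
    (a : V) : HalfSupported φ (distDeriv a u) := fun f h1 h2 => by
  have hs : tsupport (∂_{a} f : 𝓢(V, 𝕜)) ⊆ tsupport f := SchwartzMap.tsupport_lineDerivOp_subset a f
  rw [distDeriv_apply, hu _ (h1.mono' (subset_closure.trans hs)) (hs.trans h2), neg_zero]

theorem halfSupported_distDerivs {φ : StrongDual ℝ V} {u : TDist 𝕜 V} (hu : HalfSupported φ u)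
    (Y : List V) : HalfSupported φ (distDerivs Y u) := by
  induction Y with
  | nil => exact hu
  | cons a Y ih => exact halfSupported_distDeriv ih a

variable [FiniteDimensional ℝ V]

/-- A distribution killed by `∂_a` is invariant under translation by `a`, because the difference
of a test function and its translate is the `a`-derivative of a test function. -/
theorem apply_translate_of_distDeriv_eq_zero {u : TDist 𝕜 V} {a : V} (h : distDeriv a u = 0)
    (f : 𝓢(V, 𝕜)) (hf : HasCompactSupport f) : u (translate f a) = u f := by
  let _ : MeasurableSpace V := borel V
  have : BorelSpace V := ⟨rfl⟩
  obtain ⟨k, -, -, hk⟩ := exists_smear (μ := volume.restrict (Set.Icc (0 : ℝ) 1))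
    (k := (Set.Icc (0 : ℝ) 1).indicator fun _ => (1 : 𝕜))
    ((integrable_const (1 : 𝕜)).indicator measurableSet_Icc) (φ := fun t : ℝ => t • a)
    (by fun_prop) (K := (fun t : ℝ => t • a) '' Set.Icc 0 1)
    (isCompact_Icc.image (by fun_prop))
    (fun t ht => ⟨t, Set.mem_of_indicator_ne_zero ht, rfl⟩) f hf
  have h1 : (∂_{a} k : 𝓢(V, 𝕜)) = translate f a - f := by
    ext x
    rw [hk, sub_apply, translate_apply]
    have h2 : ∀ t : ℝ, HasDerivAt (fun t : ℝ => f (x + t • a))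
        ((∂_{a} f : 𝓢(V, 𝕜)) (x + t • a)) t := by
      intro t
      have h3 : HasDerivAt (fun t : ℝ => x + t • a) a t := by
        simpa using ((hasDerivAt_id t).smul_const a).const_add x
      rw [SchwartzMap.lineDerivOp_apply_eq_fderiv]
      exact (f.hasFDerivAt (x + t • a)).comp_hasDerivAt t h3
    have h4 := intervalIntegral.integral_eq_sub_of_hasDerivAt (a := 0) (b := 1)
      (fun t _ => h2 t) (Continuous.intervalIntegrable
        ((∂_{a} f : 𝓢(V, 𝕜)).continuous.comp (by fun_prop)) _ _)
    simp only [one_smul, zero_smul, add_zero] at h4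
    rw [add_comm a x, ← h4, intervalIntegral.integral_of_le zero_le_one,
      ← integral_Icc_eq_integral_Ioc]
    refine setIntegral_congr_fun measurableSet_Icc fun t ht => ?_
    simp [Set.indicator_of_mem ht]
  have h5 := congrArg (fun u : TDist 𝕜 V => u k) h
  simp only [distDeriv_apply, zero_apply, neg_eq_zero, h1, map_sub] at h5
  exact sub_eq_zero.1 h5

/-- Differentiation in a direction pointing into the half-space is injective on the distributions
supported in it: a solution of `∂_b u = 0` is translation invariant, and test functions can be
translated out of the support. -/
theorem HalfSupported.eq_zero_of_distDeriv {φ : StrongDual ℝ V} {u : TDist 𝕜 V}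
    (hu : HalfSupported φ u) {b : V} (hb : 0 < φ b) (h : distDeriv b u = 0) : u = 0 := by
  refine tdist_ext fun f hf => ?_
  obtain ⟨M, hM⟩ : ∃ M, ∀ x ∈ tsupport f, φ x ≤ M := by
    obtain ⟨M, hM⟩ := (IsCompact.image hf φ.continuous).bddAbove
    exact ⟨M, fun x hx => hM ⟨x, hx, rfl⟩⟩
  obtain ⟨s, hs⟩ : ∃ s : ℝ, M < s * φ b := ⟨(M + 1) / φ b, by
    rw [div_mul_cancel₀ _ hb.ne']; linarith⟩
  have h0 : distDeriv (s • b) u = 0 := by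
    rw [distDeriv_smul, h]
    ext f
    simp
  rw [← apply_translate_of_distDeriv_eq_zero h0 f hf]
  have heq : (translate f (s • b) : V → 𝕜) = f ∘ Homeomorph.addLeft (s • b) := by
    funext x
    simp [translate_apply]
  refine hu _ ?_ fun x hx => ?_
  · rw [heq]
    exact hf.comp_homeomorph _
  · rw [heq, tsupport_comp_eq_preimage] at hx
    have := hM _ hx
    simp only [Homeomorph.coe_addLeft, map_add, map_smul, smul_eq_mul] at this
    change φ x < 0
    linarith

theorem HalfSupported.eq_zero_of_distDerivs {φ : StrongDual ℝ V} {W : List V} :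
    ∀ {u : TDist 𝕜 V}, HalfSupported φ u → (∀ a ∈ W, 0 < φ a) → distDerivs W u = 0 →
    u = 0 := by
  induction W with
  | nil => exact fun _ _ h => h
  | cons a W ih =>
    intro u hu hW h
    refine ih hu (fun b hb => hW b (List.mem_cons_of_mem _ hb)) ?_
    exact (halfSupported_distDerivs hu W).eq_zero_of_distDeriv (hW a List.mem_cons_self) h

theorem HalfSupported.eq_of_distDerivs_eq {φ : StrongDual ℝ V} {W : List V} {u v : TDist 𝕜 V}
    (hu : HalfSupported φ u) (hv : HalfSupported φ v) (hW : ∀ a ∈ W, 0 < φ a)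
    (h : distDerivs W u = distDerivs W v) : u = v :=
  sub_eq_zero.1 ((hu.sub hv).eq_zero_of_distDerivs hW (by rw [map_sub, h, sub_self]))

end HalfSpace


/-! ### Weighted images of measures as tempered distributions -/

section Weighted

variable {𝕜 : Type*} [RCLike 𝕜] {V : Type*} [NormedAddCommGroup V] [NormedSpace ℝ V]
  [FiniteDimensional ℝ V] [MeasurableSpace V] [BorelSpace V]
  {Ω : Type*} [MeasurableSpace Ω] {μ : Measure Ω}

omit [FiniteDimensional ℝ V] [MeasurableSpace V] [BorelSpace V] in
theorem norm_apply_le_seminorm (n : ℕ) (f : 𝓢(V, 𝕜)) (x : V) :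
    ‖f x‖ ≤ ((1 + ‖x‖) ^ n)⁻¹ *
      (2 ^ n * ((Finset.Iic (n, 0)).sup (schwartzSeminormFamily 𝕜 V 𝕜)) f) := by
  have h := SchwartzMap.one_add_le_sup_seminorm_apply (𝕜 := 𝕜) (m := (n, 0)) le_rfl le_rfl f x
  rw [norm_iteratedFDeriv_zero] at h
  have hx : 0 < (1 + ‖x‖) ^ n := by positivity
  rw [← div_eq_inv_mul, le_div_iff₀ hx, mul_comm]
  exact h

variable {L : Ω → V} {k : Ω → 𝕜} {n : ℕ}

omit [FiniteDimensional ℝ V] in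
theorem integrable_weight_mul (hL : Measurable L) (hk : AEStronglyMeasurable k μ)
    (h : Integrable (fun ω => ‖k ω‖ * ((1 + ‖L ω‖) ^ n)⁻¹) μ) (f : 𝓢(V, 𝕜)) :
    Integrable (fun ω => k ω * f (L ω)) μ := by
  refine (h.mul_const (2 ^ n * ((Finset.Iic (n, 0)).sup (schwartzSeminormFamily 𝕜 V 𝕜)) f)).mono'
    (hk.mul (f.continuous.measurable.comp hL).aestronglyMeasurable)
    (Filter.Eventually.of_forall fun ω => ?_)
  rw [norm_mul, mul_assoc]
  exact mul_le_mul_of_nonneg_left (norm_apply_le_seminorm n f _) (norm_nonneg _)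

omit [FiniteDimensional ℝ V] in
/-- The functional `f ↦ ∫ k(ω) f(L(ω)) dω` is a tempered distribution if the weight `k` is
integrable against some negative power of `1 + ‖L‖`. -/
theorem exists_tdist_integral (hL : Measurable L) (hk : AEStronglyMeasurable k μ)
    (h : Integrable (fun ω => ‖k ω‖ * ((1 + ‖L ω‖) ^ n)⁻¹) μ) :
    ∃ u : TDist 𝕜 V, ∀ f, u f = ∫ ω, k ω * f (L ω) ∂μ := by
  refine ⟨SchwartzMap.mkCLMtoNormedSpace (σ := RingHom.id 𝕜) (fun f => ∫ ω, k ω * f (L ω) ∂μ)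
    (fun f g => ?_) (fun c f => ?_) ?_, fun f => rfl⟩
  · rw [← integral_add (integrable_weight_mul hL hk h f) (integrable_weight_mul hL hk h g)]
    simp [mul_add]
  · rw [RingHom.id_apply, smul_eq_mul, ← integral_const_mul]
    congr 1 with ω
    simp only [smul_apply, smul_eq_mul]
    ring
  · refine ⟨Finset.Iic (n, 0), (∫ ω, ‖k ω‖ * ((1 + ‖L ω‖) ^ n)⁻¹ ∂μ) * 2 ^ n,
      mul_nonneg (integral_nonneg fun ω => by positivity) (by positivity), fun f => ?_⟩
    rw [mul_assoc, ← integral_mul_const]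
    refine norm_integral_le_of_norm_le (h.mul_const _) (Filter.Eventually.of_forall fun ω => ?_)
    rw [norm_mul, mul_assoc]
    exact mul_le_mul_of_nonneg_left (norm_apply_le_seminorm n f _) (norm_nonneg _)

end Weighted

/-! ### Integration over a cone times a subspace -/

section Cone

variable {𝕜 : Type*} [RCLike 𝕜] {V : Type*} [NormedAddCommGroup V] [NormedSpace ℝ V]

/-- The map `(t, y) ↦ ∑ i, t_i b_i + y` attached to a list `W = (b_1, …, b_k)` and a subspace. -/
def coneMap (W : List V) (r : Submodule ℝ V) (p : (Fin W.length → ℝ) × r) : V :=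
  ∑ i, p.1 i • W.get i + p.2

theorem continuous_coneMap (W : List V) (r : Submodule ℝ V) : Continuous (coneMap W r) := by
  unfold coneMap
  exact (by fun_prop : Continuous fun p : (Fin W.length → ℝ) × r => ∑ i, p.1 i • W.get i).add
    (continuous_subtype_val.comp continuous_snd)

theorem apply_coneMap {W : List V} {r : Submodule ℝ V} {φ : StrongDual ℝ V}
    (hr : ∀ v ∈ r, φ v = 0) (p : (Fin W.length → ℝ) × r) :
    φ (coneMap W r p) = ∑ i, p.1 i * φ (W.get i) := by
  simp [coneMap, hr _ p.2.2]

/-- The orthant `t ≥ 0`, times the subspace `r`. -/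
def coneSet (W : List V) (r : Submodule ℝ V) : Set ((Fin W.length → ℝ) × r) :=
  {t | ∀ i, 0 ≤ t i} ×ˢ Set.univ

theorem apply_coneMap_nonneg {W : List V} {r : Submodule ℝ V} {φ : StrongDual ℝ V}
    (hW : ∀ a ∈ W, 0 < φ a) (hr : ∀ v ∈ r, φ v = 0) {p : (Fin W.length → ℝ) × r}
    (hp : p ∈ coneSet W r) : 0 ≤ φ (coneMap W r p) := by
  rw [apply_coneMap hr]
  exact Finset.sum_nonneg fun i _ => mul_nonneg (hp.1 i) (hW _ (List.get_mem _ _)).le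

/-- If a linear form vanishes on `r` and is positive on `W`, it bounds the coordinates of the
points of the cone, so that the parametrization of the cone is proper with linear bounds. -/
theorem exists_coneMap_bounds {W : List V} {r : Submodule ℝ V} {φ : StrongDual ℝ V}
    (hW : ∀ a ∈ W, 0 < φ a) (hr : ∀ v ∈ r, φ v = 0) :
    ∃ M A : ℝ, 0 ≤ M ∧ 0 ≤ A ∧ ∀ p ∈ coneSet W r,
      ‖p.1‖ ≤ M * φ (coneMap W r p) ∧ ‖p.2‖ ≤ ‖coneMap W r p‖ + A * φ (coneMap W r p) ∧
      ‖∑ i, p.1 i • W.get i‖ ≤ A * φ (coneMap W r p) := by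
  obtain ⟨c, hc, hcx⟩ : ∃ c : ℝ, 0 < c ∧ ∀ i, c ≤ φ (W.get i) := by
    rcases isEmpty_or_nonempty (Fin W.length) with he | hne
    · exact ⟨1, one_pos, fun i => he.elim i⟩
    · obtain ⟨i, hi⟩ := Finite.exists_min fun i => φ (W.get i)
      exact ⟨φ (W.get i), hW _ (List.get_mem _ _), hi⟩
  let B : ℝ := ∑ i, ‖W.get i‖
  have hB : 0 ≤ B := Finset.sum_nonneg fun i _ => norm_nonneg _
  refine ⟨c⁻¹, B * c⁻¹, by positivity, by positivity, fun p hp => ?_⟩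
  have h0 : ∑ i, p.1 i ≤ c⁻¹ * φ (coneMap W r p) := by
    rw [apply_coneMap hr, ← div_eq_inv_mul, le_div_iff₀ hc, Finset.sum_mul]
    exact Finset.sum_le_sum fun i _ => mul_le_mul_of_nonneg_left (hcx i) (hp.1 i)
  have h1 : ∀ i, p.1 i ≤ ∑ i, p.1 i := fun i =>
    Finset.single_le_sum (fun j _ => hp.1 j) (Finset.mem_univ i)
  have hs : 0 ≤ ∑ i, p.1 i := Finset.sum_nonneg fun i _ => hp.1 i
  have h2 : ‖∑ i, p.1 i • W.get i‖ ≤ B * c⁻¹ * φ (coneMap W r p) := by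
    refine (norm_sum_le _ _).trans ?_
    rw [mul_assoc, Finset.sum_mul]
    refine Finset.sum_le_sum fun i _ => ?_
    rw [norm_smul, Real.norm_of_nonneg (hp.1 i), mul_comm]
    exact mul_le_mul_of_nonneg_left ((h1 i).trans h0) (norm_nonneg _)
  refine ⟨?_, ?_, h2⟩
  · refine le_trans ?_ h0
    refine (pi_norm_le_iff_of_nonneg hs).2 fun i => ?_
    rw [Real.norm_of_nonneg (hp.1 i)]
    exact h1 i
  · have : (p.2 : V) = coneMap W r p - ∑ i, p.1 i • W.get i := by simp [coneMap]
    rw [← Submodule.norm_coe, this]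
    exact (norm_sub_le _ _).trans (by gcongr)

theorem exists_norm_le_coneMap {W : List V} {r : Submodule ℝ V} {φ : StrongDual ℝ V}
    (hW : ∀ a ∈ W, 0 < φ a) (hr : ∀ v ∈ r, φ v = 0) :
    ∃ M : ℝ, 1 ≤ M ∧ ∀ p ∈ coneSet W r, ‖p‖ ≤ M * ‖coneMap W r p‖ := by
  obtain ⟨M, A, hM, hA, h⟩ := exists_coneMap_bounds hW hr
  have h0 : 0 ≤ (M + A) * ‖φ‖ := by positivity
  refine ⟨1 + (M + A) * ‖φ‖, by linarith, fun p hp => ?_⟩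
  obtain ⟨h1, h2, -⟩ := h p hp
  have h3 : φ (coneMap W r p) ≤ ‖φ‖ * ‖coneMap W r p‖ :=
    (le_abs_self _).trans (φ.le_opNorm _)
  have h4 := mul_le_mul_of_nonneg_left h3 hM
  have h5 := mul_le_mul_of_nonneg_left h3 hA
  have h6 : 0 ≤ M * (‖φ‖ * ‖coneMap W r p‖) := by positivity
  have h7 : 0 ≤ A * (‖φ‖ * ‖coneMap W r p‖) := by positivity
  rw [Prod.norm_def, max_le_iff]
  constructor <;> nlinarith [norm_nonneg (coneMap W r p)]

variable [FiniteDimensional ℝ V] [MeasurableSpace V] [BorelSpace V]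

omit [FiniteDimensional ℝ V] [BorelSpace V] in
theorem measurableSet_coneSet (W : List V) (r : Submodule ℝ V) : MeasurableSet (coneSet W r) := by
  refine MeasurableSet.prod ?_ MeasurableSet.univ
  simp only [Set.ofPred_forall]
  exact MeasurableSet.iInter fun i => measurableSet_le measurable_const (measurable_pi_apply i)

/-- Lebesgue measure on the orthant, times the measure `lam` on `r`. -/
noncomputable def coneMeasure (W : List V) {r : Submodule ℝ V} (lam : Measure r) :
    Measure ((Fin W.length → ℝ) × r) :=
  (volume.prod lam).restrict (coneSet W r)

variable {W : List V} {r : Submodule ℝ V} (lam : Measure r) [lam.IsAddHaarMeasure]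
  {φ : StrongDual ℝ V}

omit [BorelSpace V] in
theorem coneMeasure_eq_prod : coneMeasure W lam =
    (volume.restrict {t : Fin W.length → ℝ | ∀ i, 0 ≤ t i}).prod lam := by
  rw [coneMeasure, coneSet, ← Measure.prod_restrict, Measure.restrict_univ]

omit [FiniteDimensional ℝ V] [BorelSpace V] [lam.IsAddHaarMeasure] in
theorem ae_coneMeasure_mem : ∀ᵐ p ∂coneMeasure W lam, p ∈ coneSet W r :=
  ae_restrict_mem (measurableSet_coneSet W r)

theorem integrable_coneMeasure {g : r → 𝕜} (hg : g ∈ polyFun 𝕜 r)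
    (hW : ∀ a ∈ W, 0 < φ a) (hr : ∀ v ∈ r, φ v = 0) :
    ∃ n : ℕ, Integrable (fun p => ‖g p.2‖ * ((1 + ‖coneMap W r p‖) ^ n)⁻¹) (coneMeasure W lam) := by
  obtain ⟨k, C, hC⟩ := (polyFun_hasTemperateGrowth hg).2 0
  obtain ⟨M, hM1, hM⟩ := exists_norm_le_coneMap hW hr
  let ν : Measure ((Fin W.length → ℝ) × r) := volume.prod lam
  have : ν.IsAddHaarMeasure := Measure.prod.instIsAddHaarMeasure _ _
  let m := ν.integrablePower
  have hi : Integrable (fun p => C * M ^ (k + m) * (1 + ‖p‖) ^ (-(m : ℝ))) ν :=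
    (Measure.integrable_pow_neg_integrablePower ν).const_mul _
  refine ⟨k + m, (hi.restrict (s := coneSet W r)).mono' ?_ ?_⟩
  · have hgc : Continuous g := (polyFun_differentiable hg).continuous
    have : Continuous fun p : (Fin W.length → ℝ) × r =>
        ‖g p.2‖ * ((1 + ‖coneMap W r p‖) ^ (k + m))⁻¹ := by
      refine (hgc.comp continuous_snd).norm.mul (Continuous.inv₀ ?_ fun p => by positivity)
      exact (continuous_const.add (continuous_coneMap W r).norm).pow _
    exact this.aestronglyMeasurable
  · filter_upwards [ae_coneMeasure_mem lam] with p hp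
    have h1 : ‖g p.2‖ ≤ C * (1 + ‖p.2‖) ^ k := by simpa using hC p.2
    have h2 : ‖p.2‖ ≤ ‖p‖ := norm_snd_le p
    have hC0 : 0 ≤ C := by simpa using (norm_nonneg _).trans (hC 0)
    have h3 : 1 + ‖p‖ ≤ M * (1 + ‖coneMap W r p‖) := by
      have := hM p hp
      nlinarith
    have hpos : 0 < 1 + ‖p‖ := by positivity
    have hpos' : 0 < 1 + ‖coneMap W r p‖ := by positivity
    rw [Real.norm_of_nonneg (by positivity), Real.rpow_neg hpos.le, Real.rpow_natCast,
      ← div_eq_mul_inv, ← div_eq_mul_inv, div_le_div_iff₀ (by positivity) (by positivity)]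
    calc ‖g p.2‖ * (1 + ‖p‖) ^ m ≤ C * (1 + ‖p‖) ^ k * (1 + ‖p‖) ^ m := by
          gcongr
          exact h1.trans (by gcongr)
      _ = C * (1 + ‖p‖) ^ (k + m) := by ring
      _ ≤ C * (M * (1 + ‖coneMap W r p‖)) ^ (k + m) := by gcongr
      _ = C * M ^ (k + m) * (1 + ‖coneMap W r p‖) ^ (k + m) := by rw [mul_pow]; ring

open scoped Classical in
variable (W) in
/-- The convolution `T_W * g` of the multivariate spline of `W` with the polynomial density `g` on
`r`, written as an integral over the orthant times `r`; it is used only when some linear form is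
positive on `W` and vanishes on `r`, which makes the integral define a tempered distribution, and
is set to `0` when the integral does not. -/
noncomputable def coneDist (g : r → 𝕜) : TDist 𝕜 V :=
  if h : ∃ u : TDist 𝕜 V, ∀ f, u f = ∫ p, g p.2 * f (coneMap W r p) ∂coneMeasure W lam
  then h.choose else 0

theorem integrable_cone {g : r → 𝕜} (hg : g ∈ polyFun 𝕜 r) (hW : ∀ a ∈ W, 0 < φ a)
    (hr : ∀ v ∈ r, φ v = 0) (f : 𝓢(V, 𝕜)) :
    Integrable (fun p => g p.2 * f (coneMap W r p)) (coneMeasure W lam) := by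
  obtain ⟨n, hn⟩ := integrable_coneMeasure lam hg hW hr
  exact integrable_weight_mul (k := fun p : (Fin W.length → ℝ) × r => g p.2)
    (continuous_coneMap W r).measurable
    ((polyFun_differentiable hg).continuous.comp continuous_snd).aestronglyMeasurable hn f

theorem coneDist_apply {g : r → 𝕜} (hg : g ∈ polyFun 𝕜 r) (hW : ∀ a ∈ W, 0 < φ a)
    (hr : ∀ v ∈ r, φ v = 0) (f : 𝓢(V, 𝕜)) :
    coneDist W lam g f = ∫ p, g p.2 * f (coneMap W r p) ∂coneMeasure W lam := by
  have h : ∃ u : TDist 𝕜 V, ∀ f, u f = ∫ p, g p.2 * f (coneMap W r p) ∂coneMeasure W lam := by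
    obtain ⟨n, hn⟩ := integrable_coneMeasure lam hg hW hr
    exact exists_tdist_integral (k := fun p : (Fin W.length → ℝ) × r => g p.2)
      (continuous_coneMap W r).measurable
      ((polyFun_differentiable hg).continuous.comp continuous_snd).aestronglyMeasurable hn
  rw [coneDist, dif_pos h]
  exact h.choose_spec f

theorem halfSupported_coneDist {g : r → 𝕜} (hg : g ∈ polyFun 𝕜 r) (hW : ∀ a ∈ W, 0 < φ a)
    (hr : ∀ v ∈ r, φ v = 0) : HalfSupported φ (coneDist W lam g) := by
  intro f _ hf
  rw [coneDist_apply lam hg hW hr]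
  refine integral_eq_zero_of_ae ?_
  filter_upwards [ae_coneMeasure_mem lam] with p hp
  have : f (coneMap W r p) = 0 := by
    by_contra h
    exact absurd (hf (subset_tsupport _ h)) (not_lt.2 (apply_coneMap_nonneg hW hr hp))
  simp [this]

/-- If the cone lies in a subspace `t`, the distribution comes from `t`. -/
theorem coneDist_mem_range {g : r → 𝕜} (hg : g ∈ polyFun 𝕜 r) (hW : ∀ a ∈ W, 0 < φ a)
    (hr : ∀ v ∈ r, φ v = 0) {t : Submodule ℝ V} (hWt : ∀ a ∈ W, a ∈ t) (hrt : r ≤ t) :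
    coneDist W lam g ∈ LinearMap.range (extendDist (𝕜 := 𝕜) t) := by
  obtain ⟨n, hn⟩ := integrable_coneMeasure lam hg hW hr
  have hmem : ∀ p, coneMap W r p ∈ t := fun p =>
    add_mem (sum_mem fun i _ => Submodule.smul_mem _ _ (hWt _ (List.get_mem _ _))) (hrt p.2.2)
  obtain ⟨v, hv⟩ := exists_tdist_integral (𝕜 := 𝕜) (V := t) (L := fun p => ⟨coneMap W r p, hmem p⟩)
    (k := fun p : (Fin W.length → ℝ) × r => g p.2) (n := n) (μ := coneMeasure W lam)
    ((continuous_coneMap W r).measurable.subtype_mk)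
    ((polyFun_differentiable hg).continuous.comp continuous_snd).aestronglyMeasurable hn
  refine ⟨v, ?_⟩
  ext f
  rw [extendDist_apply, hv, coneDist_apply lam hg hW hr]
  rfl

theorem coneDist_nil {g : r → 𝕜} (hg : g ∈ polyFun 𝕜 r) (hr : ∀ v ∈ r, φ v = 0) :
    coneDist [] lam g = extendDist r (density lam g) := by
  ext f
  rw [coneDist_apply lam hg (φ := φ) (by simp) hr, extendDist_apply, density_apply lam hg,
    coneMeasure_eq_prod]
  have h1 : {t : Fin ([] : List V).length → ℝ | ∀ i, 0 ≤ t i} = Set.univ :=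
    Set.eq_univ_of_forall fun t i => Fin.elim0 i
  have : IsEmpty (Fin ([] : List V).length) := Fin.isEmpty
  have h2 : (volume : Measure (Fin ([] : List V).length → ℝ)) =
      Measure.dirac (fun i => Fin.elim0 i) := Measure.volume_pi_eq_dirac _
  rw [h1, Measure.restrict_univ, h2, Measure.dirac_prod, integral_map
    measurable_prodMk_left.aemeasurable]
  · refine integral_congr_ae (Filter.Eventually.of_forall fun y => ?_)
    simp [coneMap, restrictSchwartz_apply]
  · exact (((polyFun_differentiable hg).continuous.comp continuous_snd).mul
      (f.continuous.comp (continuous_coneMap _ _))).aestronglyMeasurable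

end Cone


/-! ### Derivatives of the cone integrals -/

section ConeDeriv

variable {𝕜 : Type*} [RCLike 𝕜] {V : Type*} [NormedAddCommGroup V] [NormedSpace ℝ V]
  [FiniteDimensional ℝ V] [MeasurableSpace V] [BorelSpace V]
  {W : List V} {r : Submodule ℝ V} (lam : Measure r) [lam.IsAddHaarMeasure]
  {φ : StrongDual ℝ V}

omit [BorelSpace V] in
/-- Splitting off the first coordinate of the orthant. -/
theorem exists_coneMeasure_cons (b : V) :
    ∃ e : (Fin (b :: W).length → ℝ) × r ≃ᵐ ℝ × ((Fin W.length → ℝ) × r),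
      MeasurePreserving e (coneMeasure (b :: W) lam)
        ((volume.restrict (Set.Ici 0)).prod (coneMeasure W lam)) ∧
      ∀ p, p.2 = (e p).2.2 ∧
        coneMap (b :: W) r p = coneMap W r (e p).2 + (e p).1 • b := by
  let e₁ : (Fin (W.length + 1) → ℝ) ≃ᵐ ℝ × (Fin W.length → ℝ) :=
    MeasurableEquiv.piFinSuccAbove (fun _ => ℝ) 0
  have he₁ : MeasurePreserving e₁ volume volume := volume_preserving_piFinSuccAbove (fun _ => ℝ) 0
  have hset : MeasurableSet {t : Fin W.length → ℝ | ∀ i, 0 ≤ t i} := by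
    simp only [Set.ofPred_forall]
    exact MeasurableSet.iInter fun i => measurableSet_le measurable_const (measurable_pi_apply i)
  have hpre : e₁ ⁻¹' (Set.Ici 0 ×ˢ {t : Fin W.length → ℝ | ∀ i, 0 ≤ t i}) =
      {t : Fin (W.length + 1) → ℝ | ∀ i, 0 ≤ t i} := by
    ext t
    simp [e₁, MeasurableEquiv.piFinSuccAbove, Fin.forall_fin_succ, Fin.tail]
  have h2 : MeasurePreserving e₁ (volume.restrict {t : Fin (W.length + 1) → ℝ | ∀ i, 0 ≤ t i})
      ((volume.restrict (Set.Ici 0)).prod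
        (volume.restrict {t : Fin W.length → ℝ | ∀ i, 0 ≤ t i})) := by
    have := he₁.restrict_preimage ((measurableSet_Ici (a := (0 : ℝ))).prod hset)
    rwa [hpre, Measure.volume_eq_prod, ← Measure.prod_restrict] at this
  have h3 := h2.prod (MeasurePreserving.id lam)
  have h4 := (measurePreserving_prodAssoc (volume.restrict (Set.Ici (0 : ℝ)))
    (volume.restrict {t : Fin W.length → ℝ | ∀ i, 0 ≤ t i}) lam).comp h3
  refine ⟨(e₁.prodCongr (MeasurableEquiv.refl r)).trans MeasurableEquiv.prodAssoc, ?_, ?_⟩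
  · rw [coneMeasure_eq_prod, coneMeasure_eq_prod]
    exact h4
  · intro p
    refine ⟨rfl, ?_⟩
    change ∑ i : Fin (W.length + 1), p.1 i • (b :: W).get i + (p.2 : V) =
      ∑ i, p.1 (Fin.succ i) • W.get i + (p.2 : V) + p.1 0 • b
    rw [Fin.sum_univ_succ]
    simp only [List.get_cons_zero, List.get_cons_succ']
    abel

omit [FiniteDimensional ℝ V] [MeasurableSpace V] [BorelSpace V] in
theorem integral_Ici_lineDeriv {b : V} (hb : 0 < φ b) (f : 𝓢(V, 𝕜)) (hf : HasCompactSupport f)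
    (v : V) : ∫ s in Set.Ici (0 : ℝ), (∂_{b} f : 𝓢(V, 𝕜)) (v + s • b) = -f v := by
  have hb0 : b ≠ 0 := by rintro rfl; simp at hb
  have hd : ∀ s : ℝ, HasDerivAt (fun s : ℝ => f (v + s • b))
      ((∂_{b} f : 𝓢(V, 𝕜)) (v + s • b)) s := by
    intro s
    have h3 : HasDerivAt (fun s : ℝ => v + s • b) b s := by
      simpa using ((hasDerivAt_id s).smul_const b).const_add v
    rw [SchwartzMap.lineDerivOp_apply_eq_fderiv]
    exact (f.hasFDerivAt (v + s • b)).comp_hasDerivAt s h3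
  have hc : HasCompactSupport fun s : ℝ => f (v + s • b) :=
    (hf.comp_homeomorph (Homeomorph.addLeft v)).comp_isClosedEmbedding
      (isClosedEmbedding_smul_left hb0)
  have hcd : ContDiff ℝ 1 fun s : ℝ => f (v + s • b) := (f.smooth 1).comp (by fun_prop)
  have h := hc.integral_Ioi_deriv_eq hcd 0
  rw [integral_Ici_eq_integral_Ioi]
  simp only [fun s => (hd s).deriv, zero_smul, add_zero] at h
  exact h

/-- `∂_b` undoes the integration over the ray spanned by `b`. -/
theorem distDeriv_coneDist_cons {b : V} {g : r → 𝕜} (hg : g ∈ polyFun 𝕜 r)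
    (hW : ∀ a ∈ b :: W, 0 < φ a) (hr : ∀ v ∈ r, φ v = 0) :
    distDeriv b (coneDist (b :: W) lam g) = coneDist W lam g := by
  have hW' : ∀ a ∈ W, 0 < φ a := fun a ha => hW a (List.mem_cons_of_mem _ ha)
  refine tdist_ext fun f hf => ?_
  rw [distDeriv_apply, coneDist_apply lam hg hW hr, coneDist_apply lam hg hW' hr]
  obtain ⟨e, he, hep⟩ := exists_coneMeasure_cons (W := W) lam b
  let q : ℝ × ((Fin W.length → ℝ) × r) → 𝕜 := fun x =>
    g x.2.2 * (∂_{b} f : 𝓢(V, 𝕜)) (coneMap W r x.2 + x.1 • b)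
  have hq : (fun p => g p.2 * (∂_{b} f : 𝓢(V, 𝕜)) (coneMap (b :: W) r p)) = q ∘ e := by
    funext p
    simp only [q, Function.comp_apply, (hep p).2, (hep p).1]
  have hqi : Integrable q ((volume.restrict (Set.Ici 0)).prod (coneMeasure W lam)) := by
    rw [← he.integrable_comp_emb e.measurableEmbedding, ← hq]
    exact integrable_cone lam hg hW hr _
  have hsf : SFinite (coneMeasure W lam) := by rw [coneMeasure]; infer_instance
  rw [hq, Function.comp_def, he.integral_comp e.measurableEmbedding, integral_prod_symm _ hqi,
    ← integral_neg]
  refine integral_congr_ae (Filter.Eventually.of_forall fun p => ?_)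
  simp only [q]
  rw [integral_const_mul, integral_Ici_lineDeriv (hW b List.mem_cons_self) f hf, mul_neg, neg_neg]

theorem distDerivs_coneDist_append {Z : List V} {g : r → 𝕜} (hg : g ∈ polyFun 𝕜 r)
    (hr : ∀ v ∈ r, φ v = 0) : ∀ {Y : List V}, (∀ a ∈ Y ++ Z, 0 < φ a) →
    distDerivs Y (coneDist (Y ++ Z) lam g) = coneDist Z lam g
  | [], _ => rfl
  | b :: Y, h => by
    rw [distDerivs_cons, ← distDerivs_distDeriv_comm, List.cons_append,
      distDeriv_coneDist_cons (W := Y ++ Z) lam hg h hr]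
    exact distDerivs_coneDist_append hg hr fun a ha => h a (List.mem_cons_of_mem _ ha)

theorem distDerivs_coneDist {g : r → 𝕜} (hg : g ∈ polyFun 𝕜 r) (hW : ∀ a ∈ W, 0 < φ a)
    (hr : ∀ v ∈ r, φ v = 0) :
    distDerivs W (coneDist W lam g) = extendDist r (density lam g) := by
  have := distDerivs_coneDist_append (Y := W) (Z := []) lam hg hr (by simpa using hW)
  rwa [List.append_nil, coneDist_nil lam hg hr] at this

/-- The spline distribution does not depend on the order of the list: both sides are supported in
the same half-space and have the same derivative along `W`. -/
theorem coneDist_perm {W' : List V} (h : W.Perm W') {g : r → 𝕜} (hg : g ∈ polyFun 𝕜 r)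
    (hW : ∀ a ∈ W, 0 < φ a) (hr : ∀ v ∈ r, φ v = 0) :
    coneDist W lam g = coneDist W' lam g := by
  have hW' : ∀ a ∈ W', 0 < φ a := fun a ha => hW a (h.mem_iff.2 ha)
  refine (halfSupported_coneDist lam hg hW hr).eq_of_distDerivs_eq
    (halfSupported_coneDist lam hg hW' hr) hW ?_
  rw [distDerivs_coneDist lam hg hW hr, distDerivs_perm h, distDerivs_coneDist lam hg hW' hr]

theorem distDerivs_coneDist_inside {g : r → 𝕜} (hg : g ∈ polyFun 𝕜 r) (hW : ∀ a ∈ W, 0 < φ a)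
    (hr : ∀ v ∈ r, φ v = 0) (Y : List r) :
    distDerivs (Y.map Subtype.val) (coneDist W lam g) = coneDist W lam (funDeriv Y g) := by
  have hg' := funDeriv_mem_polyFun Y hg
  refine (halfSupported_distDerivs (halfSupported_coneDist lam hg hW hr) _).eq_of_distDerivs_eq
    (halfSupported_coneDist lam hg' hW hr) hW ?_
  rw [distDerivs_comm, distDerivs_coneDist lam hg hW hr, distDerivs_coneDist lam hg' hW hr,
    distDerivs_extendDist, distDerivs_density lam hg]

theorem coneDist_zero (hW : ∀ a ∈ W, 0 < φ a) (hr : ∀ v ∈ r, φ v = 0) :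
    coneDist W lam (0 : r → 𝕜) = 0 := by
  ext f
  rw [coneDist_apply lam (zero_mem _) hW hr]
  simp

end ConeDeriv

/-! ### Convolutions -/

section Convolution

variable {𝕜 : Type*} [RCLike 𝕜] {V : Type*} [NormedAddCommGroup V] [NormedSpace ℝ V]
  [FiniteDimensional ℝ V] [MeasurableSpace V] [BorelSpace V]
  {W : List V} {r : Submodule ℝ V} (lam : Measure r) [lam.IsAddHaarMeasure]
  {φ : StrongDual ℝ V}

/-- The image of the orthant under `t ↦ ∑ i, t_i b_i`. -/
def coneOf (W : List V) : Set V :=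
  (fun t : Fin W.length → ℝ => ∑ i, t i • W.get i) '' {t | ∀ i, 0 ≤ t i}

theorem dsupport_smul_multivariateSpline_subset (hW : ∀ a ∈ W, 0 < φ a) (c : 𝕜) :
    Distribution.dsupport (c • multivariateSpline 𝕜 W) ⊆ closure (coneOf W) := by
  intro x hx
  rw [Distribution.mem_dsupport_iff] at hx
  refine hx _ (fun f hf => ?_) isClosed_closure
  have h0 : multivariateSpline 𝕜 W f = 0 := by
    rw [multivariateSpline_apply ⟨φ, hW⟩]
    refine setIntegral_eq_zero_of_forall_eq_zero fun t ht => ?_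
    by_contra h
    exact hf (subset_tsupport _ h) (subset_closure ⟨t, ht, rfl⟩)
  simp [h0]

/-- A function vanishing on the support of a spline vanishes almost everywhere on the orthant
parametrizing the cone. Hence a spline only sees the values of a test function on its support, and
the test function in the definition of the convolution may be chosen freely. -/
theorem ae_eq_zero_of_eq_zero_on_dsupport {c : 𝕜} (hc : c ≠ 0) (hW : ∀ a ∈ W, 0 < φ a)
    {P : V → 𝕜} (hP : ∀ x ∈ Distribution.dsupport (c • multivariateSpline 𝕜 W), P x = 0) :
    ∀ᵐ t ∂volume.restrict {t : Fin W.length → ℝ | ∀ i, 0 ≤ t i},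
      P (∑ i, t i • W.get i) = 0 := by
  have hex : ∃ x : StrongDual ℝ V, ∀ a ∈ W, 0 < x a := ⟨φ, hW⟩
  have hT := splineMeasure_hasTemperateGrowth hex
  have hS : ∀ f : 𝓢(V, 𝕜), multivariateSpline 𝕜 W f = ∫ x, f x ∂splineMeasure W := fun f => by
    rw [multivariateSpline, dif_pos hex, SchwartzMap.integralCLM_apply]
  have hnull : splineMeasure W (Distribution.dsupport (c • multivariateSpline 𝕜 W))ᶜ = 0 := by
    refine measure_null_of_locally_null _ fun x hx => ?_
    obtain ⟨s, hs, hso, hxs⟩ := (Distribution.notMem_dsupport_iff x).1 hx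
    obtain ⟨χ, hχs, hχc, hχd, hχ01, hχx⟩ :=
      exists_contDiff_tsupport_subset (n := (⊤ : ℕ∞)) (hso.mem_nhds hxs)
    have hcs : HasCompactSupport fun x => ((χ x : ℝ) : 𝕜) :=
      hχc.comp_left (g := fun t : ℝ => (t : 𝕜)) (by simp)
    have hd : ContDiff ℝ (⊤ : ℕ∞) fun x => ((χ x : ℝ) : 𝕜) :=
      (RCLike.ofRealCLM (K := 𝕜)).contDiff.comp hχd
    have hts : tsupport (hcs.toSchwartzMap hd) ⊆ s := by
      refine (closure_mono fun y hy => ?_ : _ ⊆ tsupport χ).trans hχs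
      intro h
      apply hy
      change ((χ y : ℝ) : 𝕜) = 0
      rw [h, RCLike.ofReal_zero]
    have h1 := hs _ hts
    rw [smul_apply, smul_eq_mul, mul_eq_zero, or_iff_right hc, hS] at h1
    have h2 : ∫ x, χ x ∂splineMeasure W = 0 := by
      have : ∫ x, ((χ x : ℝ) : 𝕜) ∂splineMeasure W = 0 := h1
      rw [integral_ofReal] at this
      exact_mod_cast this
    have hint : Integrable χ (splineMeasure W) := by
      have := (hcs.toSchwartzMap hd).integrable (μ := splineMeasure W)
      have h3 : Integrable (fun x => ((χ x : ℝ) : 𝕜)) (splineMeasure W) := this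
      simpa using h3.re
    have h3 : χ =ᵐ[splineMeasure W] 0 :=
      (integral_eq_zero_iff_of_nonneg (fun y => (hχ01 ⟨y, rfl⟩).1) hint).1 h2
    refine ⟨{y | χ y ≠ 0}, mem_nhdsWithin_of_mem_nhds
      ((isOpen_ne_fun hχd.continuous continuous_const).mem_nhds (by simp [hχx])), ?_⟩
    exact h3
  rw [splineMeasure, Measure.map_apply (by fun_prop)
    Distribution.isClosed_dsupport.measurableSet.compl] at hnull
  filter_upwards [measure_eq_zero_iff_ae_notMem.1 hnull] with t ht
  exact hP _ (not_not.1 ht)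

theorem extendDist_density_translate {g : r → 𝕜} (hg : g ∈ polyFun 𝕜 r) (f : 𝓢(V, 𝕜)) (x : V) :
    extendDist r (density lam g) (translate f x) = ∫ y : r, g y * f (x + y) ∂lam := by
  rw [extendDist_apply, density_apply lam hg]
  simp only [restrictSchwartz_apply, translate_apply]

theorem coneDist_apply_eq_iterated {g : r → 𝕜} (hg : g ∈ polyFun 𝕜 r) (hW : ∀ a ∈ W, 0 < φ a)
    (hr : ∀ v ∈ r, φ v = 0) (f : 𝓢(V, 𝕜)) :
    coneDist W lam g f = ∫ t in {t : Fin W.length → ℝ | ∀ i, 0 ≤ t i},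
      extendDist r (density lam g) (translate f (∑ i, t i • W.get i)) := by
  have hi := integrable_cone lam hg hW hr f
  rw [coneDist_apply lam hg hW hr, coneMeasure_eq_prod] at *
  rw [integral_prod _ hi]
  simp only [extendDist_density_translate lam hg]
  rfl

/-- The convolution `T_W * g` exists, with the expected value: near the cone the function
`x ↦ ∫ g(y) f(x + y) dy` agrees with a compactly supported test function, obtained by restricting
the integral to a large ball. -/
theorem isConvolution_coneDist {g : r → 𝕜} (hg : g ∈ polyFun 𝕜 r) (hW : ∀ a ∈ W, 0 < φ a)
    (hr : ∀ v ∈ r, φ v = 0) (c : 𝕜) :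
    IsConvolution (c • multivariateSpline 𝕜 W) (extendDist r (density lam g))
      (c • coneDist W lam g) := by
  intro f hf
  obtain ⟨R, hR⟩ : ∃ R, ∀ x ∈ tsupport f, ‖x‖ ≤ R := by
    obtain ⟨R, hR⟩ := (IsCompact.isBounded hf).exists_norm_le
    exact ⟨R, hR⟩
  obtain ⟨M, A, hM, hA, hMA⟩ := exists_coneMap_bounds (r := r) hW hr
  -- if `x` is within distance one of the cone and `f (x + y) ≠ 0`, then `φ x ≤ ‖φ‖ * R`, so the
  -- nearby point of the cone, and with it `y`, is bounded
  let ρ : ℝ := R + A * (‖φ‖ * R + ‖φ‖) + 1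
  have hbound : ∀ x ∈ Metric.thickening 1 (coneOf W), ∀ y : r, f (x + y) ≠ 0 → ‖y‖ ≤ ρ := by
    intro x hx y hy
    obtain ⟨z, ⟨t, ht, rfl⟩, hz⟩ := Metric.mem_thickening_iff.1 hx
    have h1 := hR _ (subset_tsupport _ hy)
    have h2 := hMA (t, 0) ⟨ht, trivial⟩
    simp only [coneMap, ZeroMemClass.coe_zero, add_zero] at h2
    set z : V := ∑ i, t i • W.get i
    rw [dist_eq_norm] at hz
    have h3 : φ z ≤ ‖φ‖ * R + ‖φ‖ := by
      have h4 : φ z = φ (x + y) - φ (x - z) := by simp [hr _ y.2]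
      have h5 := (le_abs_self _).trans (φ.le_opNorm (x + y))
      have h6 := (neg_le_abs _).trans (φ.le_opNorm (x - z))
      nlinarith [norm_nonneg φ]
    have h7 : (y : V) = (x + y) - ((x - z) + z) := by abel
    rw [← Submodule.norm_coe, h7]
    refine (norm_sub_le _ _).trans ((add_le_add_right (norm_add_le _ _) _).trans ?_)
    have := mul_le_mul_of_nonneg_left h3 hA
    have := h2.2.2
    simp only [ρ]
    linarith
  have hgc : Continuous g := (polyFun_differentiable hg).continuous
  have hk : Integrable ((Metric.closedBall (0 : r) ρ).indicator g) lam :=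
    (hgc.continuousOn.integrableOn_compact (isCompact_closedBall 0 ρ)).integrable_indicator
      measurableSet_closedBall
  obtain ⟨ψ, -, hψ, -⟩ := exists_smear hk (φ := fun y : r => (y : V)) measurable_subtype_coe
    ((isCompact_closedBall (0 : r) ρ).image continuous_subtype_val)
    (fun y hy => ⟨y, Set.mem_of_indicator_ne_zero hy, rfl⟩) f hf
  have hψ' : ∀ x ∈ Metric.thickening 1 (coneOf W),
      ψ x = extendDist r (density lam g) (translate f x) := by
    intro x hx
    rw [hψ, extendDist_density_translate lam hg]
    refine integral_congr_ae (Filter.Eventually.of_forall fun y => ?_)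
    simp only []
    by_cases hy : f (x + y) = 0
    · simp [hy]
    · rw [Set.indicator_of_mem]
      simpa using hbound x hx y hy
  refine ⟨ψ, ?_, ?_⟩
  · refine Filter.mem_of_superset (Metric.isOpen_thickening.mem_nhdsSet.2 ?_) hψ'
    refine (dsupport_smul_multivariateSpline_subset hW c).trans ?_
    exact Metric.closure_subset_thickening one_pos _
  · have hset : MeasurableSet {t : Fin W.length → ℝ | ∀ i, 0 ≤ t i} := by
      simp only [Set.ofPred_forall]
      exact MeasurableSet.iInter fun i => measurableSet_le measurable_const (measurable_pi_apply i)
    rw [smul_apply, smul_apply, coneDist_apply_eq_iterated lam hg hW hr,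
      multivariateSpline_apply ⟨φ, hW⟩]
    congr 1
    refine setIntegral_congr_fun hset fun t ht => ?_
    exact (hψ' _ (Metric.self_subset_thickening one_pos _ ⟨t, ht, rfl⟩)).symm

theorem IsConvolution.eq_coneDist {g : r → 𝕜} (hg : g ∈ polyFun 𝕜 r) (hW : ∀ a ∈ W, 0 < φ a)
    (hr : ∀ v ∈ r, φ v = 0) {c : 𝕜} (hc : c ≠ 0) {u : TDist 𝕜 V}
    (hu : IsConvolution (c • multivariateSpline 𝕜 W) (extendDist r (density lam g)) u) :
    u = c • coneDist W lam g := by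
  refine tdist_ext fun f hf => ?_
  obtain ⟨ψ, h1, h2⟩ := hu f hf
  rw [h2, smul_apply, smul_apply, coneDist_apply_eq_iterated lam hg hW hr,
    multivariateSpline_apply ⟨φ, hW⟩]
  congr 1
  refine integral_congr_ae ?_
  filter_upwards [ae_eq_zero_of_eq_zero_on_dsupport hc hW
    (P := fun x => ψ x - extendDist r (density lam g) (translate f x))
    (fun x hx => sub_eq_zero.2 (h1.self_of_nhdsSet x hx))] with t ht
  exact sub_eq_zero.1 ht

end Convolution


/-! ### Distributions whose derivatives vanish -/

section Constants

variable {𝕜 : Type*} [RCLike 𝕜] {V : Type*} [NormedAddCommGroup V] [NormedSpace ℝ V]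
  [FiniteDimensional ℝ V] [MeasurableSpace V] [BorelSpace V]
  (lam : Measure V) [lam.IsAddHaarMeasure]

omit [FiniteDimensional ℝ V] [MeasurableSpace V] [BorelSpace V] in
theorem intervalIntegral_fderiv_apply (f : 𝓢(V, 𝕜)) (x y : V) :
    ∫ t in (0 : ℝ)..1, fderiv ℝ f (x - t • y) y = f x - f (x - y) := by
  have h2 : ∀ t : ℝ, HasDerivAt (fun t : ℝ => -f (x - t • y)) (fderiv ℝ f (x - t • y) y) t := by
    intro t
    have h3 : HasDerivAt (fun t : ℝ => x - t • y) (-y) t := by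
      simpa using ((hasDerivAt_id t).smul_const y).const_sub x
    have h4 := ((f.hasFDerivAt (x - t • y)).comp_hasDerivAt t h3).neg
    rw [map_neg, neg_neg] at h4
    exact h4
  have hc : Continuous fun t : ℝ => fderiv ℝ f (x - t • y) y :=
    (((f.smooth 1).continuous_fderiv (by simp)).comp (by fun_prop)).clm_apply continuous_const
  rw [intervalIntegral.integral_eq_sub_of_hasDerivAt (fun t _ => h2 t) (hc.intervalIntegrable _ _)]
  simp
  ring

/-- The convolution of two test functions `g` and `f` differs from `(∫ g) f` by a sum of
derivatives of test functions, by Taylor's formula of order one. -/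
theorem exists_convolution {w : TDist 𝕜 V} (hw : ∀ a, distDeriv a w = 0) (f g : 𝓢(V, 𝕜))
    (hf : HasCompactSupport f) (hg : HasCompactSupport g) :
    ∃ h : 𝓢(V, 𝕜), (∀ x, h x = ∫ y, g y * f (x - y) ∂lam) ∧ w h = (∫ y, g y ∂lam) * w f := by
  have hgi : Integrable g lam := g.integrable
  obtain ⟨h, -, hh, -⟩ := exists_smear hgi (φ := fun y : V => -y) measurable_neg
    (IsCompact.image hg continuous_neg) (fun y hy => ⟨y, subset_tsupport _ hy, rfl⟩) f hf
  simp only [← sub_eq_add_neg] at hh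
  refine ⟨h, hh, ?_⟩
  let b := Module.finBasis ℝ V
  let l : Fin (Module.finrank ℝ V) → StrongDual ℝ V := fun i => (b.coord i).toContinuousLinearMap
  have hl : ∀ y, ∑ i, l i y • b i = y := fun y => b.sum_repr y
  let ι : ℝ → 𝕜 := (Set.Icc (0 : ℝ) 1).indicator fun _ => 1
  have hι : Integrable ι volume := (integrable_indicator_iff measurableSet_Icc).2 (by simp)
  let k : Fin (Module.finrank ℝ V) → V × ℝ → 𝕜 := fun i p => (g p.1 * (l i p.1 : 𝕜)) * ι p.2
  have hk : ∀ i, Integrable (k i) (lam.prod volume) := by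
    intro i
    have hc : Continuous fun y => g y * (l i y : 𝕜) :=
      g.continuous.mul (RCLike.continuous_ofReal.comp (l i).continuous)
    exact (hc.integrable_of_hasCompactSupport hg.mul_right).mul_prod hι
  have hsm := fun i => exists_smear (hk i) (φ := fun p : V × ℝ => -(p.2 • p.1)) (by fun_prop)
    ((IsCompact.prod hg (isCompact_Icc (a := (0 : ℝ)) (b := 1))).image
      (f := fun p : V × ℝ => -(p.2 • p.1)) (by fun_prop))
    (fun p hp => ⟨p, ⟨subset_tsupport _ fun h0 => hp (by simp [k, h0]),
      Set.mem_of_indicator_ne_zero (f := fun _ : ℝ => (1 : 𝕜)) fun h0 => hp (by simp [k, ι, h0])⟩,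
      rfl⟩) f hf
  choose H hHc _ hH using hsm
  have key : ∑ i, (∂_{b i} (H i) : 𝓢(V, 𝕜)) = (∫ y, g y ∂lam) • f - h := by
    ext x
    have h1 : ∀ i, Integrable (fun p : V × ℝ => k i p * (∂_{b i} f : 𝓢(V, 𝕜)) (x + -(p.2 • p.1)))
        (lam.prod volume) := fun i =>
      integrable_smear (hk i) (by fun_prop) (∂_{b i} f : 𝓢(V, 𝕜)).continuous
        (hf.mono' (subset_closure.trans (SchwartzMap.tsupport_lineDerivOp_subset (b i) f))) x
    have h2 : ∀ p : V × ℝ, ∑ i, k i p * (∂_{b i} f : 𝓢(V, 𝕜)) (x + -(p.2 • p.1)) =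
        g p.1 * (ι p.2 * fderiv ℝ f (x - p.2 • p.1) p.1) := by
      intro p
      have hp : fderiv ℝ f (x - p.2 • p.1) p.1 =
          fderiv ℝ f (x - p.2 • p.1) (∑ i, l i p.1 • b i) := by rw [hl]
      rw [hp, map_sum, Finset.mul_sum, Finset.mul_sum]
      refine Finset.sum_congr rfl fun i _ => ?_
      rw [SchwartzMap.lineDerivOp_apply_eq_fderiv, map_smul, RCLike.real_smul_eq_coe_mul,
        ← sub_eq_add_neg]
      simp only [k]
      ring
    have h3 := integrable_finsetSum (μ := lam.prod volume) Finset.univ fun i _ => h1 i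
    simp only [h2] at h3
    have h4 : ∀ y, ∫ t, ι t * fderiv ℝ f (x - t • y) y = f x - f (x - y) := by
      intro y
      rw [← intervalIntegral_fderiv_apply, intervalIntegral.integral_of_le zero_le_one,
        ← integral_Icc_eq_integral_Ioc, ← integral_indicator measurableSet_Icc]
      congr 1 with t
      by_cases ht : t ∈ Set.Icc (0 : ℝ) 1 <;> simp [ι, ht]
    have h5 : Integrable (fun y => g y * f (x - y)) lam := by
      simpa only [← sub_eq_add_neg] using integrable_smear hgi measurable_neg f.continuous hf x
    rw [sum_apply, sub_apply, smul_apply, smul_eq_mul, hh]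
    simp only [hH]
    rw [← integral_finsetSum _ fun i _ => h1 i]
    simp only [h2]
    rw [integral_prod _ h3]
    simp only [integral_const_mul, h4, mul_sub]
    rw [integral_sub (hgi.mul_const _) h5, integral_mul_const]
  have h6 : w (∑ i, (∂_{b i} (H i) : 𝓢(V, 𝕜))) = 0 := by
    rw [map_sum]
    refine Finset.sum_eq_zero fun i _ => ?_
    have := congrArg (fun u : TDist 𝕜 V => u (H i)) (hw (b i))
    simpa [distDeriv_apply] using this
  rw [key, map_sub, map_smul, smul_eq_mul, sub_eq_zero] at h6
  exact h6.symm

/-- A distribution with vanishing first derivatives is a constant density: by symmetry of the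
convolution, `(∫ g) w(f) = (∫ f) w(g)`. -/
theorem exists_eq_density_const {w : TDist 𝕜 V} (hw : ∀ a, distDeriv a w = 0) :
    ∃ c : 𝕜, w = density lam fun _ => c := by
  let χ : ContDiffBump (0 : V) := ⟨1, 2, one_pos, by norm_num⟩
  have hcs : HasCompactSupport fun x => ((χ x : ℝ) : 𝕜) :=
    χ.hasCompactSupport.comp_left (g := fun t : ℝ => (t : 𝕜)) (by simp)
  have hd : ContDiff ℝ (⊤ : ℕ∞) fun x => ((χ x : ℝ) : 𝕜) :=
    (RCLike.ofRealCLM (K := 𝕜)).contDiff.comp χ.contDiff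
  let g : 𝓢(V, 𝕜) := hcs.toSchwartzMap hd
  have hg0 : ∫ x, g x ∂lam ≠ 0 := by
    have : ∫ x, g x ∂lam = ((∫ x, χ x ∂lam : ℝ) : 𝕜) := integral_ofReal
    rw [this]
    exact_mod_cast (χ.integral_pos (μ := lam)).ne'
  refine ⟨w g / ∫ x, g x ∂lam, tdist_ext fun f hf => ?_⟩
  obtain ⟨h₁, h1, h2⟩ := exists_convolution lam hw f g hf hcs
  obtain ⟨h₂, h3, h4⟩ := exists_convolution lam hw g f hcs hf
  have h5 : h₁ = h₂ := by
    ext x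
    rw [h1, h3, ← integral_sub_left_eq_self _ lam x]
    congr 1 with y
    rw [sub_sub_cancel, mul_comm]
  rw [h5, h4] at h2
  have hc : (fun _ : V => w g / ∫ x, g x ∂lam) ∈ polyFun 𝕜 V :=
    Subalgebra.algebraMap_mem (polyFun 𝕜 V) _
  rw [density_apply lam hc, integral_const_mul, div_mul_eq_mul_div, eq_div_iff hg0, mul_comm, ← h2,
    mul_comm]

end Constants

section Polynomial

variable {𝕜 : Type*} [RCLike 𝕜] {V : Type*} [NormedAddCommGroup V] [NormedSpace ℝ V]

/-- All `n`-fold derivatives of the distribution vanish. -/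
def DerivsVanish : ℕ → TDist 𝕜 V → Prop
  | 0, w => w = 0
  | n + 1, w => ∀ a, DerivsVanish n (distDeriv a w)

variable (𝕜) in
theorem coe_hasTemperateGrowth (l : StrongDual ℝ V) :
    (fun v => (l v : 𝕜)).HasTemperateGrowth :=
  (RCLike.ofRealCLM.comp l : V →L[ℝ] 𝕜).hasTemperateGrowth

/-- Multiplication of a distribution by a linear form. -/
noncomputable def mulForm (l : StrongDual ℝ V) : TDist 𝕜 V →ₗ[𝕜] TDist 𝕜 V where
  toFun u := u.comp (SchwartzMap.smulLeftCLM 𝕜 fun v => (l v : 𝕜))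
  map_add' _ _ := rfl
  map_smul' _ _ := rfl

theorem mulForm_apply (l : StrongDual ℝ V) (u : TDist 𝕜 V) (f : 𝓢(V, 𝕜)) :
    mulForm l u f = u (SchwartzMap.smulLeftCLM 𝕜 (fun v => (l v : 𝕜)) f) := rfl

theorem distDeriv_mulForm (l : StrongDual ℝ V) (a : V) (u : TDist 𝕜 V) :
    distDeriv a (mulForm l u) = mulForm l (distDeriv a u) + (l a : 𝕜) • u := by
  ext f
  have h : SchwartzMap.smulLeftCLM 𝕜 (fun v => (l v : 𝕜)) (∂_{a} f : 𝓢(V, 𝕜)) =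
      ∂_{a} (SchwartzMap.smulLeftCLM 𝕜 (fun v => (l v : 𝕜)) f) - (l a : 𝕜) • f := by
    ext x
    have h1 : HasFDerivAt (fun v => (l v : 𝕜)) (RCLike.ofRealCLM.comp l : V →L[ℝ] 𝕜) x :=
      (RCLike.ofRealCLM.comp l : V →L[ℝ] 𝕜).hasFDerivAt
    have h2 := h1.mul (f.hasFDerivAt x)
    rw [sub_apply, smul_apply, SchwartzMap.lineDerivOp_apply_eq_fderiv,
      SchwartzMap.smulLeftCLM_apply_apply (coe_hasTemperateGrowth 𝕜 l),
      SchwartzMap.lineDerivOp_apply_eq_fderiv,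
      SchwartzMap.smulLeftCLM_apply (coe_hasTemperateGrowth 𝕜 l)]
    have h3 : fderiv ℝ (fun v => (l v : 𝕜) • f v) x = _ := h2.fderiv
    rw [h3]
    simp [mul_comm]
  rw [distDeriv_apply, mulForm_apply, h, map_sub, map_smul, add_apply, smul_apply, mulForm_apply,
    distDeriv_apply]
  ring

variable [FiniteDimensional ℝ V]

/-- The Euler operator `∑ i, x_i ∂_i` in linear coordinates. -/
noncomputable def euler (w : TDist 𝕜 V) : TDist 𝕜 V :=
  ∑ i, mulForm ((Module.finBasis ℝ V).coord i).toContinuousLinearMap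
    (distDeriv (Module.finBasis ℝ V i) w)

theorem distDeriv_euler (a : V) (w : TDist 𝕜 V) :
    distDeriv a (euler w) = euler (distDeriv a w) + distDeriv a w := by
  have h : distDeriv a w = ∑ i, ((Module.finBasis ℝ V).coord i a : 𝕜) •
      distDeriv (Module.finBasis ℝ V i) w := by
    let D : V →ₗ[ℝ] TDist 𝕜 V :=
      { toFun := fun a => distDeriv a w
        map_add' := fun a b => distDeriv_add a b w
        map_smul' := fun c a => by
          rw [distDeriv_smul]
          ext f
          simp [RCLike.real_smul_eq_coe_mul] }
    change D a = ∑ i, ((Module.finBasis ℝ V).coord i a : 𝕜) • D (Module.finBasis ℝ V i)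
    conv_lhs => rw [← (Module.finBasis ℝ V).sum_repr a]
    rw [map_sum]
    refine Finset.sum_congr rfl fun i _ => ?_
    rw [map_smul]
    ext f
    simp [RCLike.real_smul_eq_coe_mul]
  conv_rhs => rw [add_comm]; arg 1; rw [h]
  rw [euler, euler, map_sum, ← Finset.sum_add_distrib]
  refine Finset.sum_congr rfl fun i _ => ?_
  rw [distDeriv_mulForm, distDeriv_comm, add_comm]
  rfl

/-- On distributions with vanishing derivatives of order `n + 1`, the operator `E - n`, for `E` the
Euler operator, lowers the order by one. -/
theorem DerivsVanish.euler_sub {n : ℕ} : ∀ {w : TDist 𝕜 V}, DerivsVanish (n + 1) w →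
    DerivsVanish n (euler w - (n : 𝕜) • w) := by
  induction n with
  | zero =>
    intro w hw
    have hw' : ∀ a, distDeriv a w = 0 := hw
    change euler w - ((0 : ℕ) : 𝕜) • w = 0
    rw [euler, Finset.sum_eq_zero fun i _ => by rw [hw', map_zero]]
    ext f
    simp
  | succ n ih =>
    intro w hw a
    have h : distDeriv a (euler w - ((n + 1 : ℕ) : 𝕜) • w) =
        euler (distDeriv a w) - (n : 𝕜) • distDeriv a w := by
      rw [map_sub, map_smul, distDeriv_euler]
      ext f
      simp
      ring
    rw [h]
    exact ih (hw a)

variable [MeasurableSpace V] [BorelSpace V] (lam : Measure V) [lam.IsAddHaarMeasure]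

variable (𝕜) in
/-- The space of polynomial densities. -/
noncomputable def polyDensity : Submodule 𝕜 (TDist 𝕜 V) where
  carrier := {w | ∃ p ∈ polyFun 𝕜 V, w = density lam p}
  zero_mem' := ⟨0, zero_mem _, (density_zero lam).symm⟩
  add_mem' := by
    rintro _ _ ⟨p, hp, rfl⟩ ⟨q, hq, rfl⟩
    exact ⟨p + q, add_mem hp hq, (density_add lam hp hq).symm⟩
  smul_mem' := by
    rintro c _ ⟨p, hp, rfl⟩
    exact ⟨c • p, Subalgebra.smul_mem _ hp c, (density_smul lam c hp).symm⟩

theorem mulForm_mem_polyDensity (l : StrongDual ℝ V) {w : TDist 𝕜 V} (hw : w ∈ polyDensity 𝕜 lam) :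
    mulForm l w ∈ polyDensity 𝕜 lam := by
  obtain ⟨p, hp, rfl⟩ := hw
  have hl : (fun v => (l v : 𝕜)) ∈ polyFun 𝕜 V := Algebra.subset_adjoin ⟨l, rfl⟩
  refine ⟨p * fun v => (l v : 𝕜), mul_mem hp hl, ?_⟩
  ext f
  rw [mulForm_apply, density_apply lam hp, density_apply lam (mul_mem hp hl)]
  simp [SchwartzMap.smulLeftCLM_apply_apply (coe_hasTemperateGrowth 𝕜 l), mul_assoc]

theorem DerivsVanish.mem_polyDensity {n : ℕ} : ∀ {w : TDist 𝕜 V}, DerivsVanish n w →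
    w ∈ polyDensity 𝕜 lam := by
  induction n with
  | zero =>
    intro w hw
    rw [show w = 0 from hw]
    exact zero_mem _
  | succ n ih =>
    intro w hw
    rcases Nat.eq_zero_or_pos n with rfl | hn
    · obtain ⟨c, hc⟩ := exists_eq_density_const lam (w := w) hw
      exact ⟨_, Subalgebra.algebraMap_mem (polyFun 𝕜 V) c, hc⟩
    · have h1 : euler w ∈ polyDensity 𝕜 lam := sum_mem fun i _ =>
        mulForm_mem_polyDensity lam _ (ih (hw _))
      have h2 := Submodule.smul_mem _ (n : 𝕜)⁻¹ (sub_mem h1 (ih hw.euler_sub))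
      have hn' : (n : 𝕜) ≠ 0 := by exact_mod_cast hn.ne'
      convert h2 using 1
      ext f
      simp [hn']

end Polynomial


/-! ### Rational subspaces -/

section Rational

variable {V : Type*} [AddCommGroup V] [Module ℝ V]

theorem isRational_span {X : List V} {S : Set V} (hS : ∀ a ∈ S, a ∈ X) :
    IsRational X (Submodule.span ℝ S) := by
  refine le_antisymm (Submodule.span_mono fun a ha => ⟨hS a ha, Submodule.subset_span ha⟩) ?_
  exact Submodule.span_le.2 fun a ha => ha.2

theorem finite_isRational (X : List V) : {r : Submodule ℝ V | IsRational X r}.Finite := by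
  refine Set.Finite.subset (X.finite_toSet.finite_subsets.image (Submodule.span ℝ)) ?_
  intro r hr
  exact ⟨{a | a ∈ X ∧ a ∈ r}, fun a ha => ha.1, hr.symm⟩

/-- A proper subspace spanned by elements of a spanning list lies in a rational hyperplane: take a
maximal proper rational subspace containing it. -/
theorem exists_rational_hyperplane [FiniteDimensional ℝ V] {X : List V}
    (hX : Submodule.span ℝ {a | a ∈ X} = ⊤) {q : Submodule ℝ V} (hq : IsRational X q)
    (hq1 : q ≠ ⊤) : ∃ H, IsRational X H ∧ Module.finrank ℝ H + 1 = Module.finrank ℝ V ∧ q ≤ H := by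
  have hfin : {r : Submodule ℝ V | IsRational X r ∧ r ≠ ⊤ ∧ q ≤ r}.Finite :=
    (finite_isRational X).subset fun r hr => hr.1
  obtain ⟨H, hH⟩ := hfin.exists_maximal ⟨q, hq, hq1, le_rfl⟩
  obtain ⟨hHr, hH1, hHq⟩ := hH.prop
  refine ⟨H, hHr, le_antisymm (Submodule.finrank_lt hH1) ?_, hHq⟩
  obtain ⟨a, haX, haH⟩ : ∃ a ∈ X, a ∉ H := by
    by_contra! hcon
    exact hH1 (top_le_iff.1 (hX ▸ Submodule.span_le.2 hcon))
  have hsup : IsRational X (H ⊔ Submodule.span ℝ {a}) := by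
    have : H ⊔ Submodule.span ℝ {a} = Submodule.span ℝ ({b | b ∈ X ∧ b ∈ H} ∪ {a}) := by
      rw [Submodule.span_union, ← hHr]
    rw [this]
    refine isRational_span ?_
    rintro b (hb | rfl)
    exacts [hb.1, haX]
  have htop : H ⊔ Submodule.span ℝ {a} = ⊤ := by
    by_contra hne
    have := hH.le_of_ge ⟨hsup, hne, hHq.trans le_sup_left⟩ le_sup_left
    exact haH (this (Submodule.mem_sup_right (Submodule.mem_span_singleton_self a)))
  have h1 := Submodule.finrank_add_le_finrank_add_finrank H (Submodule.span ℝ {a})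
  rw [htop, finrank_top] at h1
  have h2 : Module.finrank ℝ (Submodule.span ℝ {a}) ≤ 1 := by
    simpa using finrank_span_le_card (R := ℝ) ({a} : Set V)
  omega

theorem mem_inside {X : List V} {r : Submodule ℝ V} {a : r} : a ∈ inside X r ↔ (a : V) ∈ X := by
  classical
  simp only [inside, List.mem_pmap, List.mem_filter, decide_eq_true_eq]
  constructor
  · rintro ⟨b, hb, rfl⟩
    exact hb.1
  · exact fun h => ⟨a, ⟨h, a.2⟩, rfl⟩

theorem mem_outside {X : List V} {r : Submodule ℝ V} {a : V} :
    a ∈ outside X r ↔ a ∈ X ∧ a ∉ r := by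
  classical
  simp [outside]

theorem span_inside {X : List V} {r : Submodule ℝ V} (hr : IsRational X r) :
    Submodule.span ℝ {a | a ∈ inside X r} = ⊤ := by
  refine Submodule.map_injective_of_injective r.injective_subtype ?_
  rw [Submodule.map_span, Submodule.map_top, Submodule.range_subtype]
  conv_rhs => rw [hr]
  congr 1
  ext a
  simp only [Set.mem_image, Set.mem_ofPred_eq, mem_inside]
  constructor
  · rintro ⟨b, hb, rfl⟩
    exact ⟨hb, b.2⟩
  · exact fun h => ⟨⟨a, h.2⟩, h.1, rfl⟩

theorem map_val_inside (X : List V) (r : Submodule ℝ V) [DecidablePred (· ∈ r)] :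
    (inside X r).map Subtype.val = X.filter (· ∈ r) := by
  classical
  rw [inside, List.map_pmap]
  simp only [List.pmap_eq_map, List.map_id']
  exact List.filter_congr fun a _ => by simp

/-- The elements of `X ∩ r` outside a subspace `H` of `r`. -/
theorem map_val_outside_inside (X : List V) (r : Submodule ℝ V) (H : Submodule ℝ r)
    [DecidablePred fun a : V => a ∈ r ∧ a ∉ H.map r.subtype] :
    (outside (inside X r) H).map Subtype.val =
      X.filter (fun a => a ∈ r ∧ a ∉ H.map r.subtype) := by
  classical
  have h : (outside (inside X r) H) =
      (inside X r).filter ((fun a => decide (a ∉ H.map r.subtype)) ∘ Subtype.val) := by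
    rw [outside]
    congr 1
    funext a
    simp
  rw [h, ← List.filter_map, map_val_inside, List.filter_filter]
  congr 1
  funext a
  simp [Bool.and_comm]

/-- For a subspace `H` of `r`, the list `X \ H` consists of `(X ∩ r) \ H`, which is a cocircuit of
`X ∩ r` if `H` is a rational hyperplane of `r`, and of `X \ r`. -/
theorem outside_map_perm (X : List V) (r : Submodule ℝ V) (H : Submodule ℝ r) :
    (outside X (H.map r.subtype)).Perm
      ((outside (inside X r) H).map Subtype.val ++ outside X r) := by
  classical
  rw [map_val_outside_inside, outside, outside]
  have h := List.filter_append_perm (fun a => decide (a ∈ r))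
    (X.filter fun a => decide (a ∉ H.map r.subtype))
  refine h.symm.trans (List.Perm.of_eq ?_)
  rw [List.filter_filter, List.filter_filter]
  congr 1
  · congr 1
    funext a
    simp
  · congr 1
    funext a
    by_cases ha : a ∈ r
    · simp [ha]
    · simp [ha]

theorem isRational_map {X : List V} {r : Submodule ℝ V} {H : Submodule ℝ r}
    (hH : IsRational (inside X r) H) : IsRational X (H.map r.subtype) := by
  have : H.map r.subtype = Submodule.span ℝ (r.subtype '' {a | a ∈ inside X r ∧ a ∈ H}) := by
    rw [← Submodule.map_span, ← hH]
  rw [this]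
  refine isRational_span ?_
  rintro _ ⟨a, ha, rfl⟩
  exact mem_inside.1 ha.1

/-- If `t` does not contain `r` then the elements of `X` in `r` but not in `t` include a cocircuit
of `X ∩ r`. -/
theorem exists_cocircuit_sublist [FiniteDimensional ℝ V] {X : List V} {r t : Submodule ℝ V}
    (hr : IsRational X r) (h : ¬ r ≤ t) :
    ∃ Y, IsCocircuit (inside X r) Y ∧ (Y.map Subtype.val).Sublist (outside X t) := by
  classical
  let S : Set r := {a | a ∈ inside X r ∧ (a : V) ∈ t}
  have hS : IsRational (inside X r) (Submodule.span ℝ S) := isRational_span fun a ha => ha.1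
  have hSt : Submodule.span ℝ S ≤ t.comap r.subtype := Submodule.span_le.2 fun a ha => ha.2
  have hS1 : Submodule.span ℝ S ≠ ⊤ := fun htop => h fun v hv => by
    have : (⟨v, hv⟩ : r) ∈ Submodule.span ℝ S := htop ▸ Submodule.mem_top
    exact hSt this
  obtain ⟨H, hH, hH1, hSH⟩ := exists_rational_hyperplane (span_inside hr) hS hS1
  refine ⟨_, ⟨H, hH, hH1, rfl⟩, ?_⟩
  rw [map_val_outside_inside, outside]
  have : X.filter (fun a => decide (a ∈ r ∧ a ∉ H.map r.subtype)) =
      (X.filter fun a => decide (a ∉ t)).filter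
        (fun a => decide (a ∈ r ∧ a ∉ H.map r.subtype)) := by
    rw [List.filter_filter]
    refine List.filter_congr fun a ha => ?_
    by_cases h1 : a ∈ r ∧ a ∉ H.map r.subtype
    · have h2 : a ∉ t := fun hat => h1.2
        ⟨⟨a, h1.1⟩, hSH (Submodule.subset_span ⟨mem_inside.2 ha, hat⟩), rfl⟩
      simp [h1, h2]
    · simp only [h1, decide_false, Bool.false_and]
  rw [this]
  exact List.filter_sublist

end Rational

/-! ### Distributions killed by all cocircuits -/

section Nilpotent

open scoped IsMulCommutative

variable {𝕜 : Type*} [RCLike 𝕜] {V : Type*} [NormedAddCommGroup V] [NormedSpace ℝ V]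

variable (𝕜 V) in
/-- The algebra of constant-coefficient differential operators on tempered distributions. -/
noncomputable abbrev diffOps : Subalgebra 𝕜 (Module.End 𝕜 (TDist 𝕜 V)) :=
  Algebra.adjoin 𝕜 (Set.range (distDeriv : V → Module.End 𝕜 (TDist 𝕜 V)))

instance : IsMulCommutative (diffOps 𝕜 V) := by
  refine Algebra.isMulCommutative_adjoin 𝕜 ?_
  rintro _ ⟨a, rfl⟩ _ ⟨b, rfl⟩
  exact LinearMap.ext fun u => distDeriv_comm a b u

variable (𝕜) in
/-- The operator `∂_a` as an element of the algebra of differential operators. -/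
noncomputable def diffOp (a : V) : diffOps 𝕜 V :=
  ⟨distDeriv a, Algebra.subset_adjoin ⟨a, rfl⟩⟩

theorem diffOp_add (a b : V) : diffOp 𝕜 (a + b) = diffOp 𝕜 a + diffOp 𝕜 b :=
  Subtype.ext (LinearMap.ext fun u => distDeriv_add a b u)

theorem diffOp_smul (c : ℝ) (a : V) : diffOp 𝕜 (c • a) = (c : 𝕜) • diffOp 𝕜 a :=
  Subtype.ext (LinearMap.ext fun u => distDeriv_smul c a u)

theorem coe_prod_diffOp (Y : List V) (u : TDist 𝕜 V) :
    ((Y.map (diffOp 𝕜)).prod : diffOps 𝕜 V).1 u = distDerivs Y u := by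
  induction Y with
  | nil => rfl
  | cons a Y ih =>
    rw [List.map_cons, List.prod_cons, distDerivs_cons, ← ih]
    rfl

/-- The vectors `a` with `∂_a` in a given ideal of differential operators. -/
def vectorsOf (P : Ideal (diffOps 𝕜 V)) : Submodule ℝ V where
  carrier := {a | diffOp 𝕜 a ∈ P}
  zero_mem' := by
    have h : diffOp 𝕜 (0 : V) = 0 := by simpa using diffOp_smul (𝕜 := 𝕜) 0 (0 : V)
    change diffOp 𝕜 (0 : V) ∈ P
    rw [h]
    exact zero_mem P
  add_mem' := fun {a b} ha hb => by
    change diffOp 𝕜 (a + b) ∈ P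
    rw [diffOp_add]
    exact add_mem ha hb
  smul_mem' := fun c a ha => by
    change diffOp 𝕜 (c • a) ∈ P
    rw [diffOp_smul, Algebra.smul_def]
    exact P.mul_mem_left _ ha

/-- The ideal of the differential operators annihilating a distribution. -/
def annIdeal (w : TDist 𝕜 V) : Ideal (diffOps 𝕜 V) where
  carrier := {x | x.1 w = 0}
  zero_mem' := rfl
  add_mem' := fun {x y} hx hy => by
    change x.1 w + y.1 w = 0
    rw [show x.1 w = 0 from hx, show y.1 w = 0 from hy, add_zero]
  smul_mem' := fun x y hy => by
    change x.1 (y.1 w) = 0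
    rw [show y.1 w = 0 from hy, map_zero]

theorem derivsVanish_of_pow_le {I : Ideal (diffOps 𝕜 V)} (hI : ∀ a, diffOp 𝕜 a ∈ I) {n : ℕ} :
    ∀ {w : TDist 𝕜 V}, I ^ n ≤ annIdeal w → DerivsVanish n w := by
  induction n with
  | zero =>
    intro w h
    have h1 : (1 : diffOps 𝕜 V) ∈ annIdeal w := h (by
      rw [pow_zero, Ideal.one_eq_top]
      exact Submodule.mem_top)
    exact h1
  | succ n ih =>
    intro w h a
    refine ih fun x hx => ?_
    have h1 : x * diffOp 𝕜 a ∈ annIdeal w := h (by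
      rw [pow_succ]
      exact Ideal.mul_mem_mul hx (hI a))
    exact h1

theorem exists_mem_of_prod_mem {P : Ideal (diffOps 𝕜 V)} (hP : P.IsPrime) {Y : List V}
    (h : (Y.map (diffOp 𝕜)).prod ∈ P) : ∃ b ∈ Y, diffOp 𝕜 b ∈ P := by
  induction Y with
  | nil => exact absurd ((Ideal.eq_top_iff_one P).2 h) hP.ne_top
  | cons a Y ih =>
    rw [List.map_cons, List.prod_cons] at h
    rcases hP.mem_or_mem h with h | h
    · exact ⟨a, List.mem_cons_self, h⟩
    · obtain ⟨b, hb, hbP⟩ := ih h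
      exact ⟨b, List.mem_cons_of_mem _ hb, hbP⟩

variable [FiniteDimensional ℝ V]

/-- A distribution annihilated by all cocircuits of a spanning list has vanishing derivatives of
high order. A prime ideal of differential operators containing the annihilator contains `∂_a` for
some `a` in each cocircuit, so the elements `a` of `X` with `∂_a` in the prime lie in no rational
hyperplane, whence all `∂_a` are in it. Thus all `∂_a` are in the radical of the annihilator. -/
theorem exists_derivsVanish {X : List V} (hX : Submodule.span ℝ {a | a ∈ X} = ⊤) {w : TDist 𝕜 V}
    (hw : ∀ Y, IsCocircuit X Y → distDerivs Y w = 0) : ∃ n, DerivsVanish n w := by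
  have hrad : ∀ a : V, diffOp 𝕜 a ∈ (annIdeal w).radical := by
    intro a
    rw [Ideal.radical_eq_sInf, Submodule.mem_sInf]
    rintro P ⟨hP, hPp⟩
    let S : Set V := {b | b ∈ X ∧ b ∈ vectorsOf P}
    suffices h : Submodule.span ℝ S = ⊤ by
      have h1 : Submodule.span ℝ S ≤ vectorsOf P := Submodule.span_le.2 fun b hb => hb.2
      exact (h ▸ h1) (Submodule.mem_top : a ∈ (⊤ : Submodule ℝ V))
    by_contra hne
    obtain ⟨H, hH, hH1, hSH⟩ :=
      exists_rational_hyperplane hX (isRational_span (S := S) fun b hb => hb.1) hne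
    have h2 : ((outside X H).map (diffOp 𝕜)).prod ∈ P := hP (by
      change ((outside X H).map (diffOp 𝕜)).prod.1 w = 0
      rw [coe_prod_diffOp]
      exact hw _ ⟨H, hH, hH1, rfl⟩)
    obtain ⟨b, hb, hxP⟩ := exists_mem_of_prod_mem hPp h2
    obtain ⟨hbX, hbH⟩ := mem_outside.1 hb
    exact hbH (hSH (Submodule.subset_span ⟨hbX, hxP⟩))
  let b := Module.finBasis ℝ V
  let I : Ideal (diffOps 𝕜 V) := Ideal.span (Set.range fun i => diffOp 𝕜 (b i))
  have hI : ∀ a, diffOp 𝕜 a ∈ I := by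
    intro a
    have h1 : Submodule.span ℝ (Set.range b) ≤ vectorsOf I := by
      refine Submodule.span_le.2 ?_
      rintro _ ⟨i, rfl⟩
      exact Ideal.subset_span ⟨i, rfl⟩
    rw [b.span_eq] at h1
    exact h1 Submodule.mem_top
  obtain ⟨n, hn⟩ := Ideal.exists_pow_le_of_le_radical_of_fg (I := I) (J := annIdeal w)
    (Ideal.span_le.2 (by rintro _ ⟨i, rfl⟩; exact hrad _))
    (Submodule.fg_span (Set.finite_range _))
  exact ⟨n, derivsVanish_of_pow_le hI hn⟩

/-- The tempered solutions of the cocircuit equations are the polynomial densities with density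
in `D(X)`. -/
theorem exists_mem_DSpace [MeasurableSpace V] [BorelSpace V] (lam : Measure V)
    [lam.IsAddHaarMeasure] {X : List V} (hX : Submodule.span ℝ {a | a ∈ X} = ⊤) {w : TDist 𝕜 V}
    (hw : ∀ Y, IsCocircuit X Y → distDerivs Y w = 0) : ∃ g ∈ DSpace 𝕜 X, w = density lam g := by
  obtain ⟨n, hn⟩ := exists_derivsVanish hX hw
  obtain ⟨g, hg, rfl⟩ := hn.mem_polyDensity lam
  refine ⟨g, ⟨hg, fun Y hY => ?_⟩, rfl⟩
  refine eq_zero_of_density_eq_zero lam (funDeriv_mem_polyFun Y hg) ?_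
  rw [← distDerivs_density lam hg]
  exact hw Y hY

end Nilpotent


/-! ### Regular faces and oriented lists -/

section Faces

variable {V : Type*} [NormedAddCommGroup V] [NormedSpace ℝ V]

open scoped Classical in
/-- The elements of `Z` on which `φ` is positive, followed by the negatives of those on which it
is negative. -/
noncomputable def orient (φ : StrongDual ℝ V) (Z : List V) : List V :=
  Z.filter (fun a => 0 < φ a) ++ (Z.filter fun a => φ a < 0).map fun a => -a

open scoped Classical in
/-- The number of elements of `Z` on which `φ` is negative. -/
noncomputable def negCount (φ : StrongDual ℝ V) (Z : List V) : ℕ :=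
  (Z.filter fun a => φ a < 0).length

theorem pos_of_mem_orient {φ : StrongDual ℝ V} {Z : List V} : ∀ a ∈ orient φ Z, 0 < φ a := by
  intro a ha
  rcases List.mem_append.1 ha with ha | ha
  · simpa using (List.mem_filter.1 ha).2
  · obtain ⟨b, hb, rfl⟩ := List.mem_map.1 ha
    simpa using (List.mem_filter.1 hb).2

theorem mem_of_mem_orient {φ : StrongDual ℝ V} {Z : List V} {t : Submodule ℝ V}
    (h : ∀ a ∈ Z, a ∈ t) : ∀ a ∈ orient φ Z, a ∈ t := by
  intro a ha
  rcases List.mem_append.1 ha with ha | ha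
  · exact h a (List.mem_filter.1 ha).1
  · obtain ⟨b, hb, rfl⟩ := List.mem_map.1 ha
    exact neg_mem (h b (List.mem_filter.1 hb).1)

theorem orient_perm {φ : StrongDual ℝ V} {Y Z : List V} (h : Y.Perm Z) :
    (orient φ Y).Perm (orient φ Z) :=
  (h.filter _).append ((h.filter _).map _)

theorem orient_append (φ : StrongDual ℝ V) (Y Z : List V) :
    (orient φ (Y ++ Z)).Perm (orient φ Y ++ orient φ Z) := by
  simp only [orient, List.filter_append, List.map_append, List.append_assoc]
  refine List.Perm.append_left _ ?_
  rw [← List.append_assoc, ← List.append_assoc]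
  exact List.Perm.append_right _ List.perm_append_comm

theorem distDerivs_orient {𝕜 : Type*} [RCLike 𝕜] {φ : StrongDual ℝ V} {Z : List V}
    (hZ : ∀ a ∈ Z, φ a ≠ 0) (u : TDist 𝕜 V) :
    distDerivs Z u = (-1 : 𝕜) ^ negCount φ Z • distDerivs (orient φ Z) u := by
  classical
  have h := List.filter_append_perm (fun a => decide (0 < φ a)) Z
  have h1 : Z.filter (fun a => !decide (0 < φ a)) = Z.filter fun a => decide (φ a < 0) := by
    refine List.filter_congr fun a ha => ?_
    have := hZ a ha
    rcases lt_or_gt_of_ne this with h | h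
    · simp [h, h.le]
    · simp [h, h.le]
  have h2 : Z.Perm (Z.filter (fun a => 0 < φ a) ++ Z.filter fun a => φ a < 0) := by
    rw [← h1]
    exact h.symm
  have h3 : orient φ Z =
      Z.filter (fun a => 0 < φ a) ++ (Z.filter fun a => φ a < 0).map fun a => -a := by
    unfold orient
    congr!
  have h4 : negCount φ Z = (Z.filter fun a => φ a < 0).length := by
    unfold negCount
    congr!
  rw [distDerivs_perm h2, h3, h4, distDerivs_append, distDerivs_append, distDerivs_map_neg,
    map_smul]
  ext f
  simp only [smul_apply, smul_eq_mul]
  rw [← mul_assoc, ← mul_pow]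
  simp

/-- A vector of `Z` has constant sign on a regular face, by connectedness. -/
theorem IsRegularFace.pos_of_pos {Z : List V} {F : Set (StrongDual ℝ V)} (hF : IsRegularFace Z F)
    {φ ψ : StrongDual ℝ V} (hφ : φ ∈ F) (hψ : ψ ∈ F) {a : V} (ha : a ∈ Z) (h : 0 < φ a) :
    0 < ψ a := by
  obtain ⟨φ₀, hφ₀, rfl⟩ := hF
  by_contra hneg
  have hc : ContinuousOn (fun χ : StrongDual ℝ V => χ a)
      (connectedComponentIn {ψ : StrongDual ℝ V | ∀ a ∈ Z, ψ a ≠ 0} φ₀) := by fun_prop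
  obtain ⟨χ, hχ, hχ0⟩ := isPreconnected_connectedComponentIn.intermediate_value hψ hφ hc
    ⟨not_lt.1 hneg, h.le⟩
  exact connectedComponentIn_subset _ _ hχ a ha hχ0

theorem IsRegularFace.ne_zero {Z : List V} {F : Set (StrongDual ℝ V)} (hF : IsRegularFace Z F)
    {φ : StrongDual ℝ V} (hφ : φ ∈ F) : ∀ a ∈ Z, φ a ≠ 0 := by
  obtain ⟨φ₀, hφ₀, rfl⟩ := hF
  exact connectedComponentIn_subset _ _ hφ

theorem IsRegularFace.neg_of_neg {Z : List V} {F : Set (StrongDual ℝ V)} (hF : IsRegularFace Z F)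
    {φ ψ : StrongDual ℝ V} (hφ : φ ∈ F) (hψ : ψ ∈ F) {a : V} (ha : a ∈ Z) (h : φ a < 0) :
    ψ a < 0 := by
  refine lt_of_le_of_ne (not_lt.1 fun h' => ?_) (hF.ne_zero hψ a ha)
  exact (hF.pos_of_pos hψ hφ ha h').not_gt h

variable {𝕜 : Type*} [RCLike 𝕜] [FiniteDimensional ℝ V] [MeasurableSpace V] [BorelSpace V]

theorem faceSpline_eq {Z : List V} {F : Set (StrongDual ℝ V)} (hF : IsRegularFace Z F)
    {φ : StrongDual ℝ V} (hφ : φ ∈ F) :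
    faceSpline 𝕜 Z F = (-1 : 𝕜) ^ negCount φ Z • multivariateSpline 𝕜 (orient φ Z) := by
  classical
  have h1 : positivePart Z F = Z.filter fun a => 0 < φ a := by
    refine List.filter_congr fun a ha => ?_
    exact decide_eq_decide.2 ⟨fun h => h φ hφ, fun h ψ hψ => hF.pos_of_pos hφ hψ ha h⟩
  have h2 : negativePart Z F = Z.filter fun a => φ a < 0 := by
    refine List.filter_congr fun a ha => ?_
    exact decide_eq_decide.2 ⟨fun h => h φ hφ, fun h ψ hψ => hF.neg_of_neg hφ hψ ha h⟩
  have h3 : positivePart Z F ++ (negativePart Z F).map (fun a => -a) = orient φ Z := by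
    rw [h1, h2]
    unfold orient
    congr!
  have h4 : (negativePart Z F).length = negCount φ Z := by
    rw [h2]
    unfold negCount
    congr!
  rw [faceSpline, h3, h4]

end Faces

/-! ### The summands -/

section Summand

variable {𝕜 : Type*} [RCLike 𝕜] {V : Type*} [NormedAddCommGroup V] [NormedSpace ℝ V]
  [FiniteDimensional ℝ V] [MeasurableSpace V] [BorelSpace V]
  {X : List V} {r : Submodule ℝ V} {lam : Measure r} [lam.IsAddHaarMeasure]
  {F : Set (StrongDual ℝ V)} {φ : StrongDual ℝ V}

theorem neg_one_pow_ne_zero_rclike (n : ℕ) : (-1 : 𝕜) ^ n ≠ 0 := pow_ne_zero _ (by simp)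

theorem isConvolution_iff (hF : IsRegularFace (outside X r) F) (hφF : φ ∈ F)
    (hφ : ∀ v ∈ r, φ v = 0) {g : r → 𝕜} (hg : g ∈ polyFun 𝕜 r) {u : TDist 𝕜 V} :
    IsConvolution (faceSpline 𝕜 (outside X r) F) (extendDist r (density lam g)) u ↔
      u = (-1 : 𝕜) ^ negCount φ (outside X r) • coneDist (orient φ (outside X r)) lam g := by
  rw [faceSpline_eq hF hφF]
  constructor
  · exact fun hu => hu.eq_coneDist lam hg pos_of_mem_orient hφ (neg_one_pow_ne_zero_rclike _)
  · rintro rfl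
    exact isConvolution_coneDist lam hg pos_of_mem_orient hφ _

theorem mem_splineSummand (hF : IsRegularFace (outside X r) F) (hφF : φ ∈ F)
    (hφ : ∀ v ∈ r, φ v = 0) {u : TDist 𝕜 V} :
    u ∈ splineSummand 𝕜 X r lam F ↔ ∃ g ∈ DSpace 𝕜 (inside X r),
      u = (-1 : 𝕜) ^ negCount φ (outside X r) • coneDist (orient φ (outside X r)) lam g := by
  change (∃ g ∈ DSpace 𝕜 (inside X r), IsConvolution (faceSpline 𝕜 (outside X r) F)
    (extendDist r (density lam g)) u) ↔ _
  exact exists_congr fun g => and_congr_right fun hg => isConvolution_iff hF hφF hφ hg.1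

/-- `∂_{X \ r} (T_{X \ r} * g) = g`. -/
theorem distDerivs_outside_self (hφX : ∀ a ∈ outside X r, φ a ≠ 0)
    (hφ : ∀ v ∈ r, φ v = 0) {g : r → 𝕜} (hg : g ∈ polyFun 𝕜 r) :
    distDerivs (outside X r)
      ((-1 : 𝕜) ^ negCount φ (outside X r) • coneDist (orient φ (outside X r)) lam g) =
      extendDist r (density lam g) := by
  rw [map_smul, distDerivs_orient hφX, distDerivs_coneDist lam hg pos_of_mem_orient hφ]
  ext f
  simp only [smul_apply, smul_eq_mul]
  rw [← mul_assoc, ← mul_pow]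
  simp

/-- `∂_{X \ t}` annihilates the summand of `r` unless `r ≤ t`: some cocircuit of `X ∩ r` lies in
`X \ t`, and it annihilates the density. -/
theorem distDerivs_summand_eq_zero (hr : IsRational X r) (hF : IsRegularFace (outside X r) F)
    (hφF : φ ∈ F) (hφ : ∀ v ∈ r, φ v = 0) {u : TDist 𝕜 V} (hu : u ∈ splineSummand 𝕜 X r lam F)
    {t : Submodule ℝ V} (ht : ¬ r ≤ t) : distDerivs (outside X t) u = 0 := by
  obtain ⟨g, hg, rfl⟩ := (mem_splineSummand hF hφF hφ).1 hu
  obtain ⟨Y, hY, hYt⟩ := exists_cocircuit_sublist hr ht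
  refine distDerivs_eq_zero_of_sublist hYt ?_
  rw [map_smul, distDerivs_coneDist_inside lam hg.1 pos_of_mem_orient hφ, hg.2 Y hY,
    coneDist_zero lam pos_of_mem_orient hφ]
  ext f
  simp

theorem summand_eq_zero_of_distDerivs (hF : IsRegularFace (outside X r) F)
    (hφF : φ ∈ F) (hφ : ∀ v ∈ r, φ v = 0) {u : TDist 𝕜 V} (hu : u ∈ splineSummand 𝕜 X r lam F)
    (h : distDerivs (outside X r) u = 0) : u = 0 := by
  obtain ⟨g, hg, rfl⟩ := (mem_splineSummand hF hφF hφ).1 hu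
  rw [distDerivs_outside_self (hF.ne_zero hφF) hφ hg.1] at h
  have h1 : density lam g = 0 := extendDist_injective r (by rw [h, map_zero])
  rw [eq_zero_of_density_eq_zero lam hg.1 h1, coneDist_zero lam pos_of_mem_orient hφ]
  ext f
  simp

theorem splineSummand_le_splineSpace (hr : IsRational X r) (hF : IsRegularFace (outside X r) F)
    (hφF : φ ∈ F) (hφ : ∀ v ∈ r, φ v = 0) :
    splineSummand 𝕜 X r lam F ≤ splineSpace 𝕜 X := by
  classical
  intro u hu
  rw [mem_splineSpace]
  intro t _
  by_cases hrt : r ≤ t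
  swap
  · rw [distDerivs_summand_eq_zero hr hF hφF hφ hu hrt]
    exact zero_mem _
  obtain ⟨g, hg, rfl⟩ := (mem_splineSummand hF hφF hφ).1 hu
  -- `X \ r` consists of `X \ t`, which is removed by the derivative, and of vectors of `t`
  let Y : List V := (outside X r).filter fun a => decide (a ∈ t)
  have hperm : (outside X r).Perm (outside X t ++ Y) := by
    have h := List.filter_append_perm (fun a => decide (a ∈ t)) (outside X r)
    have h1 : (outside X r).filter (fun a => !decide (a ∈ t)) = outside X t := by
      rw [outside, outside, List.filter_filter]
      refine List.filter_congr fun a _ => ?_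
      by_cases hat : a ∈ t
      · simp [hat]
      · have har : a ∉ r := fun h => hat (hrt h)
        simp [hat, har]
    rw [h1] at h
    exact h.symm.trans List.perm_append_comm
  have hφt : ∀ a ∈ outside X t, φ a ≠ 0 := fun a ha =>
    hF.ne_zero hφF a (hperm.mem_iff.2 (List.mem_append_left _ ha))
  have hW := (orient_perm (φ := φ) hperm).trans (orient_append φ _ _)
  have hpos : ∀ a ∈ orient φ (outside X t) ++ orient φ Y, 0 < φ a := fun a ha =>
    pos_of_mem_orient a (hW.mem_iff.2 ha)
  rw [map_smul, distDerivs_orient hφt, coneDist_perm lam hW hg.1 pos_of_mem_orient hφ,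
    distDerivs_coneDist_append lam hg.1 hφ hpos]
  refine Submodule.smul_mem _ _ (Submodule.smul_mem _ _ ?_)
  refine coneDist_mem_range lam hg.1 pos_of_mem_orient hφ (mem_of_mem_orient fun a ha => ?_) hrt
  simpa using (List.mem_filter.1 ha).2

/-- If `u` lies in `𝒢(X)` and is annihilated by `∂_{X \ t}` for the rational `t` of dimension
smaller than that of `r`, then `∂_{X \ r} u` is a density in `D(X ∩ r)`, hence is equal to
`∂_{X \ r} v` for an element `v` of the summand of `r`. -/
theorem exists_summand_distDerivs_eq (hr : IsRational X r) (hF : IsRegularFace (outside X r) F)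
    (hφF : φ ∈ F) (hφ : ∀ v ∈ r, φ v = 0) {u : TDist 𝕜 V} (hu : u ∈ splineSpace 𝕜 X)
    (h : ∀ t, IsRational X t → Module.finrank ℝ t < Module.finrank ℝ r →
      distDerivs (outside X t) u = 0) :
    ∃ v ∈ splineSummand 𝕜 X r lam F, distDerivs (outside X r) u = distDerivs (outside X r) v := by
  obtain ⟨w, hw⟩ := mem_splineSpace.1 hu r hr
  have hwY : ∀ Y, IsCocircuit (inside X r) Y → distDerivs Y w = 0 := by
    rintro _ ⟨H, hH, hH1, rfl⟩
    refine extendDist_injective r ?_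
    rw [map_zero, ← distDerivs_extendDist, hw, ← distDerivs_append,
      ← distDerivs_perm (outside_map_perm X r H)]
    refine h _ (isRational_map hH) ?_
    rw [Submodule.finrank_map_subtype_eq]
    omega
  obtain ⟨g, hg, rfl⟩ := exists_mem_DSpace lam (span_inside hr) hwY
  refine ⟨_, (mem_splineSummand hF hφF hφ).2 ⟨g, hg, rfl⟩, ?_⟩
  rw [distDerivs_outside_self (hF.ne_zero hφF) hφ hg.1, hw]

end Summand

end Spline

open Spline in
theorem mainTheorem5 {𝕜 : Type*} [RCLike 𝕜]
    {V : Type*} [NormedAddCommGroup V] [NormedSpace ℝ V] [FiniteDimensional ℝ V]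
    [MeasurableSpace V] [BorelSpace V]
    (lam : ∀ r : Submodule ℝ V, Measure r) [∀ r, (lam r).IsAddHaarMeasure]
    (X : List V) (hX0 : ∀ a ∈ X, a ≠ 0) (hXspan : Submodule.span ℝ {a | a ∈ X} = ⊤)
    (F : Submodule ℝ V → Set (StrongDual ℝ V))
    (hF : ∀ r, IsRational X r → IsRegularFace (outside X r) (F r))
    (hFr : ∀ r, IsRational X r → ∃ φ ∈ F r, ∀ v ∈ r, φ v = 0) :
    (∀ r, IsRational X r → ∀ g ∈ DSpace 𝕜 (inside X r),
      ∃! u : TDist 𝕜 V,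
        IsConvolution (faceSpline 𝕜 (outside X r) (F r)) (extendDist r (density (lam r) g)) u) ∧
    iSupIndep (fun r : {r : Submodule ℝ V // IsRational X r} =>
      splineSummand 𝕜 X r (lam r) (F r)) ∧
    splineSpace 𝕜 X = ⨆ r : {r : Submodule ℝ V // IsRational X r},
      splineSummand 𝕜 X r (lam r) (F r) := by
  classical
  choose φ hφF hφ using hFr
  -- `∂_{X \ t}` annihilates the summands of the other subspaces of at least the same dimension
  have hzero : ∀ r t, IsRational X r → r ≠ t → Module.finrank ℝ t ≤ Module.finrank ℝ r →
      ∀ v ∈ splineSummand 𝕜 X r (lam r) (F r), distDerivs (outside X t) v = 0 := by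
    intro r t hr hne hdim v hv
    refine distDerivs_summand_eq_zero hr (hF r hr) (hφF r hr) (hφ r hr) hv fun hle => hne ?_
    exact Submodule.eq_of_le_of_finrank_le hle hdim
  refine ⟨fun r hr g hg => ?_, ?_, le_antisymm ?_ ?_⟩
  · exact ⟨_, (isConvolution_iff (hF r hr) (hφF r hr) (hφ r hr) hg.1).2 rfl, fun u hu =>
      (isConvolution_iff (hF r hr) (hφF r hr) (hφ r hr) hg.1).1 hu⟩
  · rw [iSupIndep_iff_finsetSum_eq_zero_imp_eq_zero]
    intro s v hv hsum
    by_contra! hcon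
    -- apply `∂_{X \ r}` for `r` of minimal dimension among the nonzero terms
    obtain ⟨r₀, hr₀, hne₀⟩ := hcon
    obtain ⟨r, hrs, hmin⟩ := Finset.exists_min_image (s.filter fun r => v r ≠ 0)
      (fun r => Module.finrank ℝ r.1) ⟨r₀, by simp [hr₀, hne₀]⟩
    obtain ⟨hr, hne⟩ := Finset.mem_filter.1 hrs
    refine hne (summand_eq_zero_of_distDerivs (hF r r.2) (hφF r r.2) (hφ r r.2) (hv r hr) ?_)
    have h1 := congrArg (distDerivs (outside X r.1)) hsum
    rw [map_sum, map_zero, Finset.sum_eq_single r] at h1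
    · exact h1
    · intro t ht htr
      by_cases hvt : v t = 0
      · rw [hvt, map_zero]
      · exact hzero t r t.2 (fun h => htr (Subtype.ext h))
          (hmin t (Finset.mem_filter.2 ⟨ht, hvt⟩)) _ (hv t ht)
    · exact fun h => absurd hr h
  · -- induction on the dimension up to which the derivatives `∂_{X \ t} u` vanish
    suffices key : ∀ m i, i + m = Module.finrank ℝ V + 1 → ∀ u ∈ splineSpace 𝕜 X,
        (∀ t, IsRational X t → Module.finrank ℝ t < i → distDerivs (outside X t) u = 0) →
        u ∈ ⨆ r : {r : Submodule ℝ V // IsRational X r}, splineSummand 𝕜 X r (lam r) (F r) from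
      fun u hu => key _ 0 (Nat.zero_add _) u hu fun t _ ht => absurd ht (Nat.not_lt_zero _)
    intro m
    induction m with
    | zero =>
      intro i hi u _ h
      have htop : IsRational X ⊤ := by simp [IsRational, hXspan]
      have h1 := h ⊤ htop (by rw [finrank_top]; omega)
      have h2 : outside X (⊤ : Submodule ℝ V) = [] := by simp [outside]
      rw [h2] at h1
      rw [show u = 0 from h1]
      exact zero_mem _
    | succ m ih =>
      intro i hi u hu h
      have hex : ∀ r : {r : Submodule ℝ V // IsRational X r},
          ∃ v ∈ splineSummand 𝕜 X r (lam r) (F r), Module.finrank ℝ r.1 = i →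
            distDerivs (outside X r) u = distDerivs (outside X r) v := by
        intro r
        by_cases hri : Module.finrank ℝ r.1 = i
        · obtain ⟨v, hv, hv'⟩ := exists_summand_distDerivs_eq (lam := lam r) r.2 (hF r r.2)
            (hφF r r.2) (hφ r r.2) hu fun t ht hti => h t ht (hri ▸ hti)
          exact ⟨v, hv, fun _ => hv'⟩
        · exact ⟨0, zero_mem _, fun h => absurd h hri⟩
      choose v hv hv' using hex
      have : Finite {r : Submodule ℝ V // IsRational X r} := finite_isRational X
      have : Fintype {r : Submodule ℝ V // IsRational X r} := Fintype.ofFinite _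
      let s : Finset {r : Submodule ℝ V // IsRational X r} :=
        Finset.univ.filter fun r => Module.finrank ℝ r.1 = i
      have hs : ∀ r ∈ s, Module.finrank ℝ r.1 = i := fun r hr => (Finset.mem_filter.1 hr).2
      have hsum : ∑ r ∈ s, v r ∈ ⨆ r : {r : Submodule ℝ V // IsRational X r},
          splineSummand 𝕜 X r (lam r) (F r) :=
        sum_mem fun r _ => Submodule.mem_iSup_of_mem r (hv r)
      have hsub : u - ∑ r ∈ s, v r ∈ ⨆ r : {r : Submodule ℝ V // IsRational X r},
          splineSummand 𝕜 X r (lam r) (F r) := by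
        refine ih (i + 1) (by omega) _ (sub_mem hu (sum_mem fun r _ =>
          splineSummand_le_splineSpace r.2 (hF r r.2) (hφF r r.2) (hφ r r.2) (hv r))) ?_
        intro t ht hti
        rw [map_sub, map_sum]
        rcases Nat.lt_succ_iff_lt_or_eq.1 hti with hlt | heq
        · rw [h t ht hlt, Finset.sum_eq_zero, sub_zero]
          intro r hr
          have h1 := hs r hr
          exact hzero r t r.2 (by rintro rfl; omega) (by omega) _ (hv r)
        · rw [Finset.sum_eq_single ⟨t, ht⟩, hv' ⟨t, ht⟩ heq, sub_self]
          · intro r hr hrt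
            have h1 := hs r hr
            exact hzero r t r.2 (fun h => hrt (Subtype.ext h)) (by omega) _ (hv r)
          · intro h1
            exact absurd (by simp [s, heq]) h1
      simpa using add_mem hsub hsum
  · exact iSup_le fun r =>
      splineSummand_le_splineSpace r.2 (hF r r.2) (hφF r r.2) (hφ r r.2)
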